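/- Let $P\subset\mathbb{R}^3$ be a lattice $3$-polytope, that is, a full-dimensional polytope which is the convex hull of finitely many points of $\mathbb{Z}^3$. Suppose that $P$ has width $1$: all vertices of $P$ lie in the union of two consecutive parallel lattice hyperplanes $\{x : a\cdot x=c\}$ and $\{x : a\cdot x=c+1\}$, where $a\in\mathbb{Z}^3$ is primitive and $c\in\mathbb{Z}$. Then for every integer $k\ge 2$ the dilation $kP$ has a unimodular cover, that is, $kP$ is the union of a collection of unimodular simplices (convex hulls of four lattice points $v_0,v_1,v_2,v_3\in\mathbb{Z}^3$ such that $v_1-v_0,\ v_2-v_0,\ v_3-v_0$ is a basis of $\mathbb{Z}^3$). In particular, for every empty lattice tetrahedron $T\subset\mathbb{R}^3$ (the convex hull of four affinely independent points of $\mathbb{Z}^3$ containing no point of $\mathbb{Z}^3$ other than these four) and every integer $k\ge 2$, the dilation $kT$ has a unimodular cover. -/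

import Mathlib

open scoped Pointwise

/-- The inclusion of the lattice `ℤ^d` into `ℝ^d`. -/
def latticePt {d : ℕ} (z : Fin d → ℤ) : Fin d → ℝ := fun i => (z i : ℝ)

/-- A lattice polytope in `ℝ^d`: the convex hull of a non-empty finite set of lattice points. -/
def IsLatticePolytope {d : ℕ} (P : Set (Fin d → ℝ)) : Prop :=
  ∃ S : Finset (Fin d → ℤ), S.Nonempty ∧
    P = convexHull ℝ (latticePt '' (S : Set (Fin d → ℤ)))

/-- A lattice `d`-polytope in `ℝ^d`: a lattice polytope that is full-dimensional. -/
def IsLatticeFullPolytope {d : ℕ} (P : Set (Fin d → ℝ)) : Prop :=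
  IsLatticePolytope P ∧ affineSpan ℝ P = ⊤

/-- An integer vector is primitive if its entries have no common divisor except units
(in particular it is not zero). -/
def IsPrimitiveVec {d : ℕ} (a : Fin d → ℤ) : Prop :=
  ∀ n : ℤ, (∀ i, n ∣ a i) → IsUnit n

/-- The lattice hyperplane `{x | a · x = c}`, for a primitive integer vector `a`
and an integer `c`. -/
def latticeHyperplane {d : ℕ} (a : Fin d → ℤ) (c : ℤ) : Set (Fin d → ℝ) :=
  {x | ∑ i, (a i : ℝ) * x i = (c : ℝ)}

/-- Width one: all the vertices lie in two consecutive parallel lattice hyperplanes. -/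
def HasWidthOne {d : ℕ} (P : Set (Fin d → ℝ)) : Prop :=
  ∃ (a : Fin d → ℤ) (c : ℤ), IsPrimitiveVec a ∧
    P.extremePoints ℝ ⊆ latticeHyperplane a c ∪ latticeHyperplane a (c + 1)

/-- A unimodular simplex in `ℝ^d`: the convex hull of `d + 1` lattice points `v 0, …, v d`
such that the vectors `v i - v 0`, `i = 1, …, d`, form a basis of `ℤ^d`, that is,
such that the integer matrix with these rows has determinant `1` or `-1`. -/
def IsUnimodularSimplex {d : ℕ} (T : Set (Fin d → ℝ)) : Prop :=
  ∃ v : Fin (d + 1) → (Fin d → ℤ),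
    IsUnit (Matrix.of (fun i j : Fin d => v i.succ j - v 0 j)).det ∧
    T = convexHull ℝ (Set.range (fun i => latticePt (v i)))

/-- A unimodular cover of `P`: a collection of unimodular simplices whose union equals `P`. -/
def HasUnimodularCover {d : ℕ} (P : Set (Fin d → ℝ)) : Prop :=
  ∃ C : Set (Set (Fin d → ℝ)), (∀ T ∈ C, IsUnimodularSimplex T) ∧ ⋃₀ C = P

/-- An empty lattice tetrahedron in `ℝ^3`: the convex hull of four affinely independent
lattice points that contains no lattice points other than these four. -/
def IsEmptyTetrahedron (T : Set (Fin 3 → ℝ)) : Prop :=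
  ∃ v : Fin 4 → (Fin 3 → ℤ),
    AffineIndependent ℝ (fun i => latticePt (v i)) ∧
    T = convexHull ℝ (Set.range (fun i => latticePt (v i))) ∧
    ∀ z : Fin 3 → ℤ, latticePt z ∈ T → z ∈ Set.range v

/-! Both claims reduce to an empty tetrahedron of width one. By Carathéodory, a point of a lattice
polytope lies in a nondegenerate lattice tetrahedron with vertices among the given points
(`exists_tet_of_mem_convexHull`), and cutting at further lattice points leaves an empty tetrahedron
around it (`exists_isEmptyTet`). If the polytope lies between consecutive lattice planes, so does
this tetrahedron. An arbitrary empty tetrahedron has width one by White's theorem, which is proved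
here as a statement on sums of floors (`floor_sum_ordered`, `residues_opposite`).

With levels split 3-1, an empty tetrahedron has a facet at lattice distance one from the opposite
vertex and is unimodular (`IsEmptyTet.natAbs_vol_eq_one_of_facet`); a unimodular one is also split
2-2 by another form. So the case that carries the theorem is `IsTwoTwo`.

For `k = 2` the middle slice of `2T` is a lattice parallelogram. Pyramids over it with lattice apex
at distance one decompose into unimodular simplices (`covered_pyramid`). Between two such pyramids a
wedge remains, covered by joining a primitive segment to the steps of a lattice path across the
parallelogram (`IsTwoTwo.covered_two_mixed`). For `k = 3`, a point with a barycentric weight at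
least one lies in a translate of `2T`, and pyramids cover the rest (`IsTwoTwo.covered_three_of_le`).
From `k = 4` on, four weights of sum `k` always include one that is at least one, so induction by
translation finishes. -/

/-! ### Integer geometry in coordinates -/

/-- The pairing of two integer vectors. -/
def dot3 (a x : Fin 3 → ℤ) : ℤ := a 0 * x 0 + a 1 * x 1 + a 2 * x 2

/-- The determinant of three integer vectors. -/
def det3 (x y z : Fin 3 → ℤ) : ℤ :=
  x 0 * (y 1 * z 2 - y 2 * z 1) - x 1 * (y 0 * z 2 - y 2 * z 0) + x 2 * (y 0 * z 1 - y 1 * z 0)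

/-- The cross product of two integer vectors. -/
def cross3 (x y : Fin 3 → ℤ) : Fin 3 → ℤ :=
  ![x 1 * y 2 - x 2 * y 1, x 2 * y 0 - x 0 * y 2, x 0 * y 1 - x 1 * y 0]

/-- The signed normalized volume of a lattice tetrahedron. -/
def vol (v : Fin 4 → Fin 3 → ℤ) : ℤ := det3 (v 1 - v 0) (v 2 - v 0) (v 3 - v 0)

theorem vol_eq_det (v : Fin 4 → Fin 3 → ℤ) :
    (Matrix.of (fun i j : Fin 3 => v i.succ j - v 0 j)).det = vol v := by
  rw [Matrix.det_fin_three]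
  simp only [vol, det3, Matrix.of_apply, Pi.sub_apply, Fin.succ_zero_eq_one, Fin.succ_one_eq_two]
  have : Fin.succ (2 : Fin 3) = (3 : Fin 4) := rfl
  rw [this]
  ring

/-- This form treats the four vertices alike, so relabelling them is a row permutation and an affine
dependence is a kernel vector. -/
theorem vol_eq_det_homogeneous (v : Fin 4 → Fin 3 → ℤ) :
    (Matrix.of (fun i => ![1, v i 0, v i 1, v i 2])).det = vol v := by
  simp [Matrix.det_succ_row_zero, Fin.sum_univ_succ, Fin.succAbove, vol, det3]
  ring

theorem natAbs_vol_comp_perm (v : Fin 4 → Fin 3 → ℤ) (σ : Equiv.Perm (Fin 4)) :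
    (vol (v ∘ σ)).natAbs = (vol v).natAbs := by
  rw [← vol_eq_det_homogeneous, ← vol_eq_det_homogeneous v]
  have h := Matrix.det_permute σ (Matrix.of (fun i => ![1, v i 0, v i 1, v i 2]))
  have h2 : (Matrix.of (fun i => ![1, (v ∘ σ) i 0, (v ∘ σ) i 1, (v ∘ σ) i 2])) =
      (Matrix.of (fun i => ![1, v i 0, v i 1, v i 2])).submatrix σ id := rfl
  rw [h2, h]
  rcases Int.units_eq_one_or (Equiv.Perm.sign σ) with hσ | hσ <;> simp [hσ]

/-- Cramer's rule: barycentric coordinates are ratios of volumes. -/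
theorem vol_update (v : Fin 4 → Fin 3 → ℤ) (z : Fin 3 → ℤ) (μ : Fin 4 → ℝ) (hs : ∑ i, μ i = 1)
    (hz : ∀ j, (z j : ℝ) = ∑ i, μ i * v i j) (i : Fin 4) :
    (vol (Function.update v i z) : ℝ) = μ i * vol v := by
  simp only [Fin.sum_univ_four] at hs hz
  have h0 : μ 0 = 1 - μ 1 - μ 2 - μ 3 := by linarith
  fin_cases i <;>
  simp [vol, det3, Function.update, hz, h0] <;> ring

/-! ### Lattice tetrahedra and their dilations -/

/-- The tetrahedron spanned by four lattice points. -/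
def tet (v : Fin 4 → Fin 3 → ℤ) : Set (Fin 3 → ℝ) :=
  convexHull ℝ (Set.range fun i => latticePt (v i))

/-- The points with nonnegative barycentric coordinates of total weight `k`. -/
def dil (v : Fin 4 → Fin 3 → ℤ) (k : ℝ) : Set (Fin 3 → ℝ) :=
  {x | ∃ l : Fin 4 → ℝ, (∀ i, 0 ≤ l i) ∧ ∑ i, l i = k ∧ ∀ j, x j = ∑ i, l i * v i j}

theorem convex_dil (v : Fin 4 → Fin 3 → ℤ) (k : ℝ) : Convex ℝ (dil v k) := by
  rintro x ⟨l, hl, hs, hx⟩ y ⟨m, hm, ht, hy⟩ a b ha hb hab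
  refine ⟨fun i => a * l i + b * m i, fun i => ?_, ?_, fun j => ?_⟩
  · have := hl i; have := hm i; positivity
  · rw [Finset.sum_add_distrib, ← Finset.mul_sum, ← Finset.mul_sum, hs, ht, ← add_mul, hab, one_mul]
  · simp only [Pi.add_apply, Pi.smul_apply, smul_eq_mul, hx, hy, Fin.sum_univ_four]
    ring

theorem tet_eq_dil_one (v : Fin 4 → Fin 3 → ℤ) : tet v = dil v 1 := by
  apply Set.Subset.antisymm
  · refine convexHull_min ?_ (convex_dil v 1)
    rintro _ ⟨i, rfl⟩
    refine ⟨Pi.single i 1, fun j => ?_, by simp, fun j => ?_⟩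
    · by_cases h : j = i
      · subst h; simp
      · simp [h]
    · simp [latticePt, Pi.single_apply]
  · rintro x ⟨l, hl, hs, hx⟩
    refine mem_convexHull_of_exists_fintype l (fun i => latticePt (v i)) hl hs
      (fun i => Set.mem_range_self i) ?_
    ext j
    simp [hx, latticePt]

theorem mem_tet {v : Fin 4 → Fin 3 → ℤ} {x : Fin 3 → ℝ} : x ∈ tet v ↔
    ∃ l : Fin 4 → ℝ, (∀ i, 0 ≤ l i) ∧ ∑ i, l i = 1 ∧ ∀ j, x j = ∑ i, l i * v i j := by
  rw [tet_eq_dil_one]; rfl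

theorem smul_tet (v : Fin 4 → Fin 3 → ℤ) {k : ℝ} (hk : 0 < k) : k • tet v = dil v k := by
  ext x
  rw [Set.mem_smul_set_iff_inv_smul_mem₀ hk.ne', mem_tet]
  constructor
  · rintro ⟨l, hl, hs, hx⟩
    refine ⟨fun i => k * l i, fun i => mul_nonneg hk.le (hl i), by rw [← Finset.mul_sum, hs, mul_one],
      fun j => ?_⟩
    have := hx j
    simp only [Pi.smul_apply, smul_eq_mul] at this
    rw [inv_mul_eq_iff_eq_mul₀ hk.ne'] at this
    rw [this, Finset.mul_sum]
    exact Finset.sum_congr rfl fun i _ => by ring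
  · rintro ⟨l, hl, hs, hx⟩
    refine ⟨fun i => k⁻¹ * l i, fun i => mul_nonneg (inv_nonneg.2 hk.le) (hl i),
      by rw [← Finset.mul_sum, hs, inv_mul_cancel₀ hk.ne'], fun j => ?_⟩
    simp only [Pi.smul_apply, smul_eq_mul, hx, Finset.mul_sum]
    exact Finset.sum_congr rfl fun i _ => by ring

theorem latticePt_mem_tet (v : Fin 4 → Fin 3 → ℤ) (i : Fin 4) : latticePt (v i) ∈ tet v :=
  subset_convexHull ℝ _ (Set.mem_range_self i)

theorem tet_subset {v : Fin 4 → Fin 3 → ℤ} {K : Set (Fin 3 → ℝ)} (hK : Convex ℝ K)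
    (h : ∀ i, latticePt (v i) ∈ K) : tet v ⊆ K :=
  convexHull_min (by rintro _ ⟨i, rfl⟩; exact h i) hK

theorem tet_comp_perm (v : Fin 4 → Fin 3 → ℤ) (σ : Equiv.Perm (Fin 4)) : tet (v ∘ σ) = tet v := by
  unfold tet
  congr 1
  exact σ.surjective.range_comp fun i => latticePt (v i)

theorem dil_comp_perm (v : Fin 4 → Fin 3 → ℤ) {k : ℝ} (hk : 0 < k) (σ : Equiv.Perm (Fin 4)) :
    dil (v ∘ σ) k = dil v k := by
  rw [← smul_tet _ hk, ← smul_tet _ hk, tet_comp_perm]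

/-- The point `x` lies in a unimodular simplex contained in `K`. -/
def Covered (K : Set (Fin 3 → ℝ)) (x : Fin 3 → ℝ) : Prop :=
  ∃ v : Fin 4 → Fin 3 → ℤ, (vol v).natAbs = 1 ∧ x ∈ tet v ∧ tet v ⊆ K

theorem Covered.mono {K L : Set (Fin 3 → ℝ)} {x : Fin 3 → ℝ} (h : Covered K x) (hKL : K ⊆ L) :
    Covered L x := by
  obtain ⟨v, h1, h2, h3⟩ := h
  exact ⟨v, h1, h2, h3.trans hKL⟩

theorem hasUnimodularCover_of_covered {K : Set (Fin 3 → ℝ)} (h : ∀ x ∈ K, Covered K x) :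
    HasUnimodularCover K := by
  refine ⟨{T | IsUnimodularSimplex T ∧ T ⊆ K}, fun T hT => hT.1, ?_⟩
  apply Set.Subset.antisymm
  · exact Set.sUnion_subset fun T hT => hT.2
  · intro x hx
    obtain ⟨v, h1, h2, h3⟩ := h x hx
    refine ⟨tet v, ⟨⟨v, ?_, rfl⟩, h3⟩, h2⟩
    rw [vol_eq_det]
    exact Int.isUnit_iff_natAbs_eq.2 h1

/-- A nondegenerate lattice tetrahedron without lattice points other than its vertices. -/
def IsEmptyTet (v : Fin 4 → Fin 3 → ℤ) : Prop :=
  vol v ≠ 0 ∧ ∀ z : Fin 3 → ℤ, latticePt z ∈ tet v → z ∈ Set.range v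

theorem IsEmptyTet.comp_perm {v : Fin 4 → Fin 3 → ℤ} (h : IsEmptyTet v) (σ : Equiv.Perm (Fin 4)) :
    IsEmptyTet (v ∘ σ) := by
  refine ⟨?_, fun z hz => ?_⟩
  · rw [← Int.natAbs_ne_zero, natAbs_vol_comp_perm, Int.natAbs_ne_zero]
    exact h.1
  · rw [tet_comp_perm] at hz
    rw [σ.surjective.range_comp]
    exact h.2 z hz

/-- Replacing a vertex by a further lattice point of the tetrahedron. -/
theorem exists_smaller_tet {v : Fin 4 → Fin 3 → ℤ} (hv : vol v ≠ 0) {z : Fin 3 → ℤ}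
    (hz : latticePt z ∈ tet v) (hzv : z ∉ Set.range v) {x : Fin 3 → ℝ} (hx : x ∈ tet v) :
    ∃ w, vol w ≠ 0 ∧ (vol w).natAbs < (vol v).natAbs ∧ x ∈ tet w ∧ tet w ⊆ tet v := by
  obtain ⟨μ, hμ, hμs, hzμ⟩ := mem_tet.1 hz
  obtain ⟨l, hl, hls, hxl⟩ := mem_tet.1 hx
  -- Stellar subdivision at `z`: the minimal ratio is the largest multiple of `μ` that can be
  -- subtracted from `l` with all weights staying nonnegative, so `x` lies in the piece where `z`
  -- replaces vertex `i`.
  obtain ⟨i, hi, hmin⟩ : ∃ i ∈ Finset.univ.filter (fun i => 0 < μ i),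
      ∀ j ∈ Finset.univ.filter (fun i => 0 < μ i), l i / μ i ≤ l j / μ j := by
    apply Finset.exists_min_image
    by_contra hne
    rw [Finset.not_nonempty_iff_eq_empty, Finset.filter_eq_empty_iff] at hne
    have : ∑ i, μ i ≤ 0 := Finset.sum_nonpos fun i _ => not_lt.1 (hne (Finset.mem_univ i))
    linarith
  simp only [Finset.mem_filter, Finset.mem_univ, true_and] at hi hmin
  have hμi : μ i < 1 := by
    by_contra hge
    have hj : ∀ j, j ≠ i → μ j = 0 := by
      intro j hji
      have h1 : ∑ k ∈ ({i, j} : Finset (Fin 4)), μ k ≤ ∑ k, μ k :=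
        Finset.sum_le_sum_of_subset_of_nonneg (Finset.subset_univ _) fun k _ _ => hμ k
      rw [Finset.sum_pair hji.symm, hμs] at h1
      have := hμ j
      linarith [not_lt.1 hge]
    have h1 : μ i = 1 := by
      rw [Finset.sum_eq_single i (fun j _ hji => hj j hji) (by simp)] at hμs
      exact hμs
    apply hzv
    refine ⟨i, ?_⟩
    ext c
    have := hzμ c
    rw [Finset.sum_eq_single i (fun j _ hji => by rw [hj j hji, zero_mul]) (by simp), h1,
      one_mul] at this
    simp only [latticePt] at this
    exact_mod_cast this.symm
  have hvol := vol_update v z μ hμs hzμ i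
  have hvR : (vol v : ℝ) ≠ 0 := by exact_mod_cast hv
  refine ⟨Function.update v i z, ?_, ?_, ?_, ?_⟩
  · have : (vol (Function.update v i z) : ℝ) ≠ 0 := by rw [hvol]; positivity
    exact_mod_cast this
  · have : |(vol (Function.update v i z) : ℝ)| < |(vol v : ℝ)| := by
      rw [hvol, abs_mul, abs_of_pos hi]
      have := abs_pos.2 hvR
      nlinarith
    have h2 : |vol (Function.update v i z)| < |vol v| := by exact_mod_cast this
    zify
    exact h2
  · rw [mem_tet]
    set t := l i / μ i with ht
    have hti : t * μ i = l i := div_mul_cancel₀ _ hi.ne'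
    have ht0 : 0 ≤ t := div_nonneg (hl i) hi.le
    refine ⟨fun j => if j = i then t else l j - t * μ j, fun j => ?_, ?_, fun c => ?_⟩
    · dsimp only
      split_ifs with h
      · exact ht0
      · rcases (hμ j).eq_or_lt with h0 | h0
        · rw [← h0]; simpa using hl j
        · have := hmin j h0
          rw [le_div_iff₀ h0] at this
          linarith
    · have : ∀ j, (if j = i then t else l j - t * μ j) =
          (l j - t * μ j) + if j = i then t else 0 := by
        intro j
        split_ifs with h
        · subst h; linarith
        · ring
      simp only [this, Finset.sum_add_distrib, Finset.sum_sub_distrib, ← Finset.mul_sum, hls, hμs,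
        Finset.sum_ite_eq', Finset.mem_univ, if_true]
      ring
    · have : ∀ j, (if j = i then t else l j - t * μ j) * (Function.update v i z j c : ℝ) =
          (l j * v j c - t * (μ j * v j c)) + if j = i then t * z c else 0 := by
        intro j
        split_ifs with h
        · subst h
          simp only [Function.update_self]
          rw [← hti]; ring
        · rw [Function.update_of_ne h]; ring
      simp only [this, Finset.sum_add_distrib, Finset.sum_sub_distrib, ← Finset.mul_sum, ← hzμ, ← hxl,
        Finset.sum_ite_eq', Finset.mem_univ, if_true, latticePt]
      ring
  · refine tet_subset (convex_convexHull ℝ _) fun j => ?_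
    by_cases h : j = i
    · subst h; simpa using hz
    · rw [Function.update_of_ne h]; exact latticePt_mem_tet v j

/-- A lattice tetrahedron is a union of empty ones. -/
theorem exists_isEmptyTet {v : Fin 4 → Fin 3 → ℤ} (hv : vol v ≠ 0) {x : Fin 3 → ℝ}
    (hx : x ∈ tet v) : ∃ w, IsEmptyTet w ∧ x ∈ tet w ∧ tet w ⊆ tet v := by
  induction hn : (vol v).natAbs using Nat.strong_induction_on generalizing v with
  | _ n ih =>
    by_cases he : IsEmptyTet v
    · exact ⟨v, he, hx, subset_rfl⟩
    · simp only [IsEmptyTet, not_and, not_forall] at he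
      obtain ⟨z, hz, hzv⟩ := he hv
      obtain ⟨w, hw, hlt, hxw, hsub⟩ := exists_smaller_tet hv hz hzv hx
      obtain ⟨w', h1, h2, h3⟩ := ih _ (hn ▸ hlt) hw hxw rfl
      exact ⟨w', h1, h2, h3.trans hsub⟩

/-! ### Lattice bases adapted to a linear form -/

theorem exists_dot3_eq_one {n : Fin 3 → ℤ} (hn : IsPrimitiveVec n) : ∃ g, dot3 n g = 1 := by
  obtain ⟨d, hd⟩ := (IsPrincipalIdealRing.principal (Ideal.span (Set.range n))).principal
  have hdu : IsUnit d := hn d fun i => by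
    have h : n i ∈ Ideal.span (Set.range n) := Ideal.subset_span (Set.mem_range_self i)
    rw [hd] at h
    exact Ideal.mem_span_singleton.1 h
  have h1 : (1 : ℤ) ∈ Ideal.span (Set.range n) := by
    rw [hd]
    exact Ideal.mem_span_singleton.2 hdu.dvd
  obtain ⟨c, hc⟩ := Ideal.mem_span_range_iff_exists_fun.1 h1
  refine ⟨c, ?_⟩
  rw [Fin.sum_univ_three] at hc
  rw [← hc, dot3]
  ring

/-- Since `a` vanishes on `u` and is `1` on `f`, the entries of `u` are integer combinations of
those of `f × u`, which is therefore primitive. A vector pairing to `1` with it completes `u, f` to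
a basis; subtracting a multiple of `f` moves it into the kernel of `a`. -/
theorem exists_adapted_vector {a f u : Fin 3 → ℤ} (hu : IsPrimitiveVec u) (hau : dot3 a u = 0)
    (haf : dot3 a f = 1) : ∃ e, dot3 a e = 0 ∧ det3 u e f = 1 := by
  have hn : IsPrimitiveVec (cross3 f u) := by
    intro d hd
    apply hu
    have h0 := hd 0
    have h1 := hd 1
    have h2 := hd 2
    simp only [cross3, Matrix.cons_val_zero, Matrix.cons_val_one, Matrix.cons_val] at h0 h1 h2
    simp only [dot3] at hau haf
    intro i
    fin_cases i <;> simp only [Fin.zero_eta, Fin.mk_one, Fin.reduceFinMk, Fin.isValue]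
    · have : u 0 = a 2 * (f 2 * u 0 - f 0 * u 2) - a 1 * (f 0 * u 1 - f 1 * u 0) := by
        linear_combination (-u 0) * haf + f 0 * hau
      rw [this]
      exact dvd_sub (h1.mul_left _) (h2.mul_left _)
    · have : u 1 = a 0 * (f 0 * u 1 - f 1 * u 0) - a 2 * (f 1 * u 2 - f 2 * u 1) := by
        linear_combination (-u 1) * haf + f 1 * hau
      rw [this]
      exact dvd_sub (h2.mul_left _) (h0.mul_left _)
    · have : u 2 = a 1 * (f 1 * u 2 - f 2 * u 1) - a 0 * (f 2 * u 0 - f 0 * u 2) := by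
        linear_combination (-u 2) * haf + f 2 * hau
      rw [this]
      exact dvd_sub (h0.mul_left _) (h1.mul_left _)
  obtain ⟨g, hg⟩ := exists_dot3_eq_one hn
  refine ⟨fun i => g i - dot3 a g * f i, ?_, ?_⟩
  · simp only [dot3] at haf ⊢
    linear_combination (-(a 0 * g 0 + a 1 * g 1 + a 2 * g 2)) * haf
  · simp only [dot3, cross3, Matrix.cons_val_zero, Matrix.cons_val_one, Matrix.cons_val] at hg
    simp only [det3, dot3]
    linear_combination hg

theorem eq_combination_of_dot3_eq_zero {a f u e w : Fin 3 → ℤ} (hau : dot3 a u = 0)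
    (haf : dot3 a f = 1) (hae : dot3 a e = 0) (hdet : det3 u e f = 1) (haw : dot3 a w = 0)
    (j : Fin 3) : w j = det3 w e f * u j + det3 u w f * e j := by
  have cramer : ∀ j, det3 u e f * w j =
      det3 w e f * u j + det3 u w f * e j + det3 u e w * f j := by
    intro j
    fin_cases j <;> simp [det3] <;> ring
  have h0 : det3 u e w = 0 := by
    have c0 := cramer 0
    have c1 := cramer 1
    have c2 := cramer 2
    rw [hdet] at c0 c1 c2
    simp only [dot3] at hau haf hae haw
    linear_combination (-det3 u e w) * haf + haw - a 0 * c0 - a 1 * c1 - a 2 * c2 -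
      det3 w e f * hau - det3 u w f * hae
  have := cramer j
  rw [hdet, h0] at this
  linarith

/-- Multiplying the three equations by the adjugate of the edge matrix gives `vol v • a = 0`. -/
theorem vol_eq_zero_of_coplanar {a f : Fin 3 → ℤ} (haf : dot3 a f = 1) {v : Fin 4 → Fin 3 → ℤ}
    (h1 : dot3 a (v 1 - v 0) = 0) (h2 : dot3 a (v 2 - v 0) = 0) (h3 : dot3 a (v 3 - v 0) = 0) :
    vol v = 0 := by
  have key : ∀ j, vol v * a j = 0 := by
    intro j
    simp only [dot3, Pi.sub_apply] at h1 h2 h3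
    fin_cases j <;> simp only [vol, det3, Pi.sub_apply, Fin.zero_eta, Fin.mk_one, Fin.reduceFinMk]
    · linear_combination
        ((v 2 1 - v 0 1) * (v 3 2 - v 0 2) - (v 2 2 - v 0 2) * (v 3 1 - v 0 1)) * h1 +
        ((v 3 1 - v 0 1) * (v 1 2 - v 0 2) - (v 3 2 - v 0 2) * (v 1 1 - v 0 1)) * h2 +
        ((v 1 1 - v 0 1) * (v 2 2 - v 0 2) - (v 1 2 - v 0 2) * (v 2 1 - v 0 1)) * h3
    · linear_combination
        ((v 2 2 - v 0 2) * (v 3 0 - v 0 0) - (v 2 0 - v 0 0) * (v 3 2 - v 0 2)) * h1 +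
        ((v 3 2 - v 0 2) * (v 1 0 - v 0 0) - (v 3 0 - v 0 0) * (v 1 2 - v 0 2)) * h2 +
        ((v 1 2 - v 0 2) * (v 2 0 - v 0 0) - (v 1 0 - v 0 0) * (v 2 2 - v 0 2)) * h3
    · linear_combination
        ((v 2 0 - v 0 0) * (v 3 1 - v 0 1) - (v 2 1 - v 0 1) * (v 3 0 - v 0 0)) * h1 +
        ((v 3 0 - v 0 0) * (v 1 1 - v 0 1) - (v 3 1 - v 0 1) * (v 1 0 - v 0 0)) * h2 +
        ((v 1 0 - v 0 0) * (v 2 1 - v 0 1) - (v 1 1 - v 0 1) * (v 2 0 - v 0 0)) * h3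
  have : vol v * dot3 a f = 0 := by
    simp only [dot3]
    linear_combination f 0 * key 0 + f 1 * key 1 + f 2 * key 2
  rwa [haf, mul_one] at this

theorem injective_of_vol_ne_zero {v : Fin 4 → Fin 3 → ℤ} (hv : vol v ≠ 0) :
    Function.Injective v := by
  intro i j hij
  by_contra hne
  apply hv
  rw [← vol_eq_det_homogeneous]
  exact Matrix.det_zero_of_row_eq hne (by ext c; simp only [Matrix.of_apply, hij])

theorem IsEmptyTet.isPrimitiveVec {v : Fin 4 → Fin 3 → ℤ} (hv : IsEmptyTet v) :
    IsPrimitiveVec (v 1 - v 0) := by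
  intro d hd
  choose y hy using hd
  simp only [Pi.sub_apply] at hy
  rw [Int.isUnit_iff_natAbs_eq]
  by_contra hd1
  have hd0 : d ≠ 0 := by
    rintro rfl
    exact hv.1 (by simp [vol, det3, hy])
  have hdR : (1 : ℝ) ≤ |(d : ℝ)| := by
    have : 1 ≤ |d| := Int.one_le_abs hd0
    exact_mod_cast this
  -- If `|d| ≥ 2`, this is a lattice point interior to the edge; `d.sign` keeps it on the edge when
  -- `d < 0`.
  have hmem : latticePt (fun j => v 0 j + d.sign * y j) ∈ tet v := by
    rw [mem_tet]
    refine ⟨![1 - |(d : ℝ)|⁻¹, |(d : ℝ)|⁻¹, 0, 0], fun i => ?_, ?_, fun j => ?_⟩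
    · fin_cases i <;> simp
      exact inv_le_one_of_one_le₀ hdR
    · simp [Fin.sum_univ_four]
    · have h1 : (v 1 j : ℝ) = v 0 j + d * y j := by
        have := hy j
        have h2 : v 1 j = v 0 j + d * y j := by linarith
        exact_mod_cast h2
      have h2 : (d : ℝ) = (d.sign : ℝ) * |(d : ℝ)| := by
        have := Int.sign_mul_abs d
        exact_mod_cast this.symm
      have h3 : |(d : ℝ)|⁻¹ * |(d : ℝ)| = 1 := inv_mul_cancel₀ (by linarith)
      simp [Fin.sum_univ_four, latticePt, h1]
      linear_combination (-(d.sign : ℝ) * y j) * h3 - |(d : ℝ)|⁻¹ * y j * h2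
  obtain ⟨k, hk⟩ := hv.2 _ hmem
  have hk' : ∀ j, v k j = v 0 j + d.sign * y j := fun j => congrFun hk j
  have hvol := hv.1
  have hs : d.sign ≠ 0 := by rwa [Ne, Int.sign_eq_zero_iff_zero]
  fin_cases k <;> simp only [Fin.zero_eta, Fin.mk_one, Fin.reduceFinMk, Fin.isValue] at hk'
  · have : ∀ j, y j = 0 := fun j => by
      have := hk' j
      have h2 : d.sign * y j = 0 := by linarith
      exact (mul_eq_zero.1 h2).resolve_left hs
    exact hvol (by simp [vol, det3, hy, this])
  · have hdd : d ≠ d.sign := by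
      intro h
      apply hd1
      rw [h, Int.natAbs_sign_of_ne_zero hd0]
    have : ∀ j, y j = 0 := fun j => by
      have := hk' j
      have h2 : (d - d.sign) * y j = 0 := by linarith [hy j]
      exact (mul_eq_zero.1 h2).resolve_left (sub_ne_zero.2 hdd)
    exact hvol (by simp [vol, det3, hy, this])
  · apply hvol
    simp [vol, det3, hy, hk']
    ring
  · apply hvol
    simp [vol, det3, hy, hk']
    ring

/-- An empty tetrahedron with a facet at lattice distance one from the opposite vertex is
unimodular. -/
theorem IsEmptyTet.natAbs_vol_eq_one_of_facet {v : Fin 4 → Fin 3 → ℤ} (hv : IsEmptyTet v)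
    {a : Fin 3 → ℤ} (h1 : dot3 a (v 1 - v 0) = 0) (h2 : dot3 a (v 2 - v 0) = 0)
    (h3 : dot3 a (v 3 - v 0) = 1) : (vol v).natAbs = 1 := by
  obtain ⟨e, hae, hdet⟩ := exists_adapted_vector hv.isPrimitiveVec h1 h3
  have hw := eq_combination_of_dot3_eq_zero h1 h3 hae hdet h2
  have hq : det3 (v 1 - v 0) (v 2 - v 0) (v 3 - v 0) = vol v := rfl
  rw [hq] at hw
  generalize det3 (v 2 - v 0) e (v 3 - v 0) = p at hw
  by_contra hne
  have hv0 := hv.1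
  obtain ⟨s, Q, hs, hsQ, hQ2⟩ : ∃ s Q : ℤ, (s = 1 ∨ s = -1) ∧ vol v = s * Q ∧ 2 ≤ Q := by
    rcases le_or_gt 0 (vol v) with h | h
    · exact ⟨1, vol v, Or.inl rfl, by ring, by omega⟩
    · exact ⟨-1, -vol v, Or.inr rfl, by ring, by omega⟩
  -- In the basis `u, e` of the facet plane the triangle is `0, (1,0), (p, sQ)`. The row at height
  -- `s` meets it in abscissas from `p/Q` to `(p+Q-1)/Q`, an interval that contains `m = ⌈p/Q⌉`. The
  -- resulting lattice point is no vertex once `Q ≥ 2`.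
  obtain ⟨m, hm0, hm1⟩ : ∃ m : ℤ, 0 ≤ m * Q - p ∧ m * Q - p ≤ Q - 1 := by
    refine ⟨-((-p) / Q), ?_, ?_⟩
    · have := Int.ediv_mul_le (-p) (show Q ≠ 0 by omega)
      linarith
    · have := Int.lt_ediv_add_one_mul_self (-p) (show 0 < Q by omega)
      linarith
  have hQR : (Q : ℝ) ≠ 0 := by
    have : Q ≠ 0 := by omega
    exact_mod_cast this
  have hQ0 : (0 : ℝ) ≤ Q := by
    have : 0 ≤ Q := by omega
    exact_mod_cast this
  have hmem : latticePt (fun j => v 0 j + m * (v 1 j - v 0 j) + s * e j) ∈ tet v := by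
    rw [mem_tet]
    refine ⟨![(Q - 1 - (m * Q - p)) / Q, (m * Q - p) / Q, 1 / Q, 0], fun i => ?_, ?_, fun j => ?_⟩
    · have hm0' : (0 : ℝ) ≤ m * Q - p := by exact_mod_cast hm0
      have hm1' : (m * Q - p : ℝ) ≤ Q - 1 := by exact_mod_cast hm1
      fin_cases i <;> simp
      · exact div_nonneg (by linarith) hQ0
      · exact div_nonneg (by linarith) hQ0
      · exact_mod_cast hQ0
    · simp [Fin.sum_univ_four]
      field_simp
      ring
    · have h := hw j
      rw [hsQ] at h
      simp only [Pi.sub_apply] at h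
      have h' : (v 2 j : ℝ) = v 0 j + p * (v 1 j - v 0 j) + s * Q * e j := by
        have : v 2 j = v 0 j + p * (v 1 j - v 0 j) + s * Q * e j := by linarith
        exact_mod_cast this
      simp [Fin.sum_univ_four, latticePt, h']
      field_simp
      ring
  obtain ⟨k, hk⟩ := hv.2 _ hmem
  have hk' : ∀ j, v k j - v 0 j = m * (v 1 j - v 0 j) + s * e j := fun j => by
    rw [congrFun hk j]; ring
  have hdk : det3 (v 1 - v 0) (v k - v 0) (v 3 - v 0) = s := by
    simp only [det3, Pi.sub_apply, hk'] at hdet ⊢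
    linear_combination s * hdet
  fin_cases k <;> simp only [Fin.zero_eta, Fin.mk_one, Fin.reduceFinMk, Fin.isValue] at hdk
  · have : det3 (v 1 - v 0) (v 0 - v 0) (v 3 - v 0) = 0 := by simp [det3]
    omega
  · have : det3 (v 1 - v 0) (v 1 - v 0) (v 3 - v 0) = 0 := by simp only [det3]; ring
    omega
  · rw [hq] at hdk
    omega
  · have : det3 (v 1 - v 0) (v 3 - v 0) (v 3 - v 0) = 0 := by simp only [det3]; ring
    omega

theorem dot3_sub (a x y : Fin 3 → ℤ) : dot3 a (x - y) = dot3 a x - dot3 a y := by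
  simp only [dot3, Pi.sub_apply]; ring

theorem dot3_neg_left (a x : Fin 3 → ℤ) : dot3 (-a) x = -dot3 a x := by
  simp only [dot3, Pi.neg_apply]; ring

/-- A lattice point of a tetrahedron with one vertex at level `0` and the others at level `1`
is that vertex or is at level `1`. -/
theorem eq_apex_or_dot3_eq_one {w : Fin 4 → Fin 3 → ℤ} {a : Fin 3 → ℤ}
    (h1 : dot3 a (w 1 - w 0) = 1) (h2 : dot3 a (w 2 - w 0) = 1) (h3 : dot3 a (w 3 - w 0) = 1)
    {z : Fin 3 → ℤ} (hz : latticePt z ∈ tet w) : z = w 0 ∨ dot3 a (z - w 0) = 1 := by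
  obtain ⟨l, hl, hs, hzl⟩ := mem_tet.1 hz
  simp only [Fin.sum_univ_four, latticePt] at hs hzl
  have hd : (dot3 a (z - w 0) : ℝ) = 1 - l 0 := by
    have h1' : (dot3 a (w 1 - w 0) : ℝ) = 1 := by exact_mod_cast h1
    have h2' : (dot3 a (w 2 - w 0) : ℝ) = 1 := by exact_mod_cast h2
    have h3' : (dot3 a (w 3 - w 0) : ℝ) = 1 := by exact_mod_cast h3
    simp only [dot3, Pi.sub_apply] at h1' h2' h3' ⊢
    push_cast at h1' h2' h3' ⊢
    rw [hzl, hzl, hzl]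
    linear_combination l 1 * h1' + l 2 * h2' + l 3 * h3' +
      (a 0 * w 0 0 + a 1 * w 0 1 + a 2 * w 0 2 + 1) * hs
  have hle : (dot3 a (z - w 0) : ℝ) ≤ 1 := by linarith [hl 0]
  have hge : (0 : ℝ) ≤ dot3 a (z - w 0) := by linarith [hl 1, hl 2, hl 3]
  have hle' : dot3 a (z - w 0) ≤ 1 := by exact_mod_cast hle
  have hge' : 0 ≤ dot3 a (z - w 0) := by exact_mod_cast hge
  rcases (by omega : dot3 a (z - w 0) = 0 ∨ dot3 a (z - w 0) = 1) with h | h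
  · left
    rw [h] at hd
    push_cast at hd
    have e1 : l 1 = 0 := by linarith [hl 1, hl 2, hl 3]
    have e2 : l 2 = 0 := by linarith [hl 1, hl 2, hl 3]
    have e3 : l 3 = 0 := by linarith [hl 1, hl 2, hl 3]
    ext j
    have := hzl j
    rw [e1, e2, e3, show l 0 = 1 by linarith] at this
    simp only [one_mul, zero_mul, add_zero] at this
    exact_mod_cast this
  · exact Or.inr h

/-- Every lattice point other than the apex lies in the base plane, so each empty piece must use the
apex and have its opposite facet in that plane, at distance one. -/
theorem covered_cone {w : Fin 4 → Fin 3 → ℤ} (hw : vol w ≠ 0) {a : Fin 3 → ℤ}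
    (h1 : dot3 a (w 1 - w 0) = 1) (h2 : dot3 a (w 2 - w 0) = 1) (h3 : dot3 a (w 3 - w 0) = 1)
    {x : Fin 3 → ℝ} (hx : x ∈ tet w) : Covered (tet w) x := by
  obtain ⟨v, hv, hxv, hvw⟩ := exists_isEmptyTet hw hx
  have hlev : ∀ i, v i = w 0 ∨ dot3 a (v i - w 0) = 1 := fun i =>
    eq_apex_or_dot3_eq_one h1 h2 h3 (hvw (latticePt_mem_tet v i))
  obtain ⟨i, hi⟩ : ∃ i, v i = w 0 := by
    by_contra hne
    push Not at hne
    have h := fun i => (hlev i).resolve_left (hne i)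
    simp only [dot3_sub] at h
    apply hv.1
    apply vol_eq_zero_of_coplanar h1 <;> rw [dot3_sub] <;> linarith [h 0, h 1, h 2, h 3]
  have hj : ∀ j, j ≠ i → dot3 a (v j) - dot3 a (w 0) = 1 := fun j hji => by
    rw [← dot3_sub]
    refine (hlev j).resolve_left fun h => hji ?_
    exact injective_of_vol_ne_zero hv.1 (h.trans hi.symm)
  refine ⟨v, ?_, hxv, hvw⟩
  rw [← natAbs_vol_comp_perm v (Equiv.swap 3 i)]
  have hne : ∀ j : Fin 4, j ≠ 3 → dot3 a (v (Equiv.swap 3 i j)) - dot3 a (w 0) = 1 := by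
    intro j hj3
    apply hj
    intro h
    apply hj3
    rw [← Equiv.swap_apply_left 3 i] at h
    exact (Equiv.swap 3 i).injective h
  have e0 := hne 0 (by decide)
  have e1 := hne 1 (by decide)
  have e2 := hne 2 (by decide)
  apply (hv.comp_perm (Equiv.swap 3 i)).natAbs_vol_eq_one_of_facet (a := -a) <;>
    rw [dot3_neg_left, dot3_sub] <;> simp only [Function.comp_apply, Equiv.swap_apply_left, hi] <;>
    linarith

/-- Pyramids over lattice parallelograms at lattice distance one from the apex. -/
theorem covered_pyramid {K : Set (Fin 3 → ℝ)} (hK : Convex ℝ K) {o p q r : Fin 3 → ℤ}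
    (ho : latticePt o ∈ K) (hp : latticePt p ∈ K) (hq : latticePt q ∈ K) (hr : latticePt r ∈ K)
    (hs : latticePt (q + r - p) ∈ K) {a : Fin 3 → ℤ} (hap : dot3 a (p - o) = 1)
    (haq : dot3 a (q - o) = 1) (har : dot3 a (r - o) = 1) (hvol : vol ![o, p, q, r] ≠ 0)
    {x : Fin 3 → ℝ} {τ X Y : ℝ} (hτ : τ ≤ 1) (hX : 0 ≤ X) (hXτ : X ≤ τ) (hY : 0 ≤ Y) (hYτ : Y ≤ τ)
    (hx : ∀ j, x j = (1 - τ) * o j + τ * p j + X * (q j - p j) + Y * (r j - p j)) :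
    Covered K x := by
  rcases le_total (X + Y) τ with h | h
  · have hmem : x ∈ tet ![o, p, q, r] := by
      rw [mem_tet]
      refine ⟨![1 - τ, τ - X - Y, X, Y], fun i => ?_, ?_, fun j => ?_⟩
      · fin_cases i <;> simp <;> linarith
      · simp [Fin.sum_univ_four]; ring
      · simp [Fin.sum_univ_four, hx]; ring
    refine (covered_cone hvol hap haq har hmem).mono (tet_subset hK fun i => ?_)
    fin_cases i <;> assumption
  · have hmem : x ∈ tet ![o, q + r - p, q, r] := by
      rw [mem_tet]
      refine ⟨![1 - τ, X + Y - τ, τ - Y, τ - X], fun i => ?_, ?_, fun j => ?_⟩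
      · fin_cases i <;> simp <;> linarith
      · simp [Fin.sum_univ_four]; ring
      · simp [Fin.sum_univ_four, hx]; ring
    have hvol' : vol ![o, q + r - p, q, r] ≠ 0 := by
      have : vol ![o, q + r - p, q, r] = -vol ![o, p, q, r] := by
        simp [vol, det3]; ring
      rw [this]
      exact neg_ne_zero.2 hvol
    have has : dot3 a (q + r - p - o) = 1 := by
      simp only [dot3, Pi.sub_apply, Pi.add_apply] at *
      linarith
    refine (covered_cone hvol' has haq har hmem).mono (tet_subset hK fun i => ?_)
    fin_cases i <;> assumption

/-! ### Tetrahedra with two vertices on each of two consecutive lattice planes -/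

theorem mem_dil_of {v : Fin 4 → Fin 3 → ℤ} {k : ℝ} {x : Fin 3 → ℝ} (l0 l1 l2 l3 : ℝ)
    (h0 : 0 ≤ l0) (h1 : 0 ≤ l1) (h2 : 0 ≤ l2) (h3 : 0 ≤ l3) (hs : l0 + l1 + l2 + l3 = k)
    (hx : ∀ j, x j = l0 * v 0 j + l1 * v 1 j + l2 * v 2 j + l3 * v 3 j) : x ∈ dil v k := by
  refine ⟨![l0, l1, l2, l3], fun i => ?_, ?_, fun j => ?_⟩
  · fin_cases i <;> assumption
  · simpa [Fin.sum_univ_four] using hs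
  · simpa [Fin.sum_univ_four] using hx j

/-- An empty tetrahedron with two vertices at level `0` and two at level `1`. -/
structure IsTwoTwo (v : Fin 4 → Fin 3 → ℤ) (a : Fin 3 → ℤ) : Prop where
  empty : IsEmptyTet v
  one : dot3 a (v 1 - v 0) = 0
  two : dot3 a (v 2 - v 0) = 1
  three : dot3 a (v 3 - v 0) = 1

theorem IsTwoTwo.swap_bottom {v : Fin 4 → Fin 3 → ℤ} {a : Fin 3 → ℤ} (h : IsTwoTwo v a) :
    IsTwoTwo (v ∘ Equiv.swap 0 1) a := by
  obtain ⟨h0, h1, h2, h3⟩ := h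
  have e2 : Equiv.swap (0 : Fin 4) 1 2 = 2 := by decide
  have e3 : Equiv.swap (0 : Fin 4) 1 3 = 3 := by decide
  rw [dot3_sub] at h1 h2 h3
  refine ⟨h0.comp_perm _, ?_, ?_, ?_⟩ <;> rw [dot3_sub] <;> simp [e2, e3] <;> linarith

/-- The permutation exchanging the vertices at level `0` and those at level `1`. -/
def exchangeLevels : Equiv.Perm (Fin 4) := Equiv.swap 0 2 * Equiv.swap 1 3

theorem exchangeLevels_apply : exchangeLevels 0 = 2 ∧ exchangeLevels 1 = 3 ∧
    exchangeLevels 2 = 0 ∧ exchangeLevels 3 = 1 := by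
  decide

theorem IsTwoTwo.exchange {v : Fin 4 → Fin 3 → ℤ} {a : Fin 3 → ℤ} (h : IsTwoTwo v a) :
    IsTwoTwo (v ∘ exchangeLevels) (-a) := by
  obtain ⟨h0, h1, h2, h3⟩ := h
  obtain ⟨e0, e1, e2, e3⟩ := exchangeLevels_apply
  rw [dot3_sub] at h1 h2 h3
  refine ⟨h0.comp_perm _, ?_, ?_, ?_⟩ <;> rw [dot3_neg_left, dot3_sub] <;>
    simp [e0, e1, e2, e3] <;> linarith

theorem exists_strip_index {Q : ℤ} (hQ : 1 ≤ Q) {t b : ℝ} (hb : 0 ≤ b) (hbt : b ≤ t) :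
    ∃ i : ℤ, 0 ≤ i ∧ i + 1 ≤ Q ∧ t * i ≤ Q * b ∧ Q * b ≤ t * (i + 1) := by
  rcases hb.eq_or_lt with h0 | h0
  · exact ⟨0, le_rfl, by omega, by simp [← h0], by simpa [← h0] using hbt⟩
  have ht : 0 < t := h0.trans_le hbt
  have hQR : (1 : ℝ) ≤ Q := by exact_mod_cast hQ
  rcases hbt.eq_or_lt with h1 | h1
  · refine ⟨Q - 1, by omega, by omega, ?_, ?_⟩
    · push_cast; rw [h1]; nlinarith
    · push_cast; rw [h1]; nlinarith
  · refine ⟨⌊Q * b / t⌋, ?_, ?_, ?_, ?_⟩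
    · exact Int.floor_nonneg.2 (by positivity)
    · have : ⌊(Q : ℝ) * b / t⌋ < Q := by
        rw [Int.floor_lt, div_lt_iff₀ ht]
        nlinarith
      omega
    · have := Int.floor_le ((Q : ℝ) * b / t)
      rw [le_div_iff₀ ht] at this
      linarith
    · have := (Int.lt_floor_add_one ((Q : ℝ) * b / t)).le
      rw [div_le_iff₀ ht] at this
      linarith

/-- The middle parallelogram of `2T` has one side along the primitive vector `v 1 - v 0`, so each of
its `Q + 1` lattice rows in that direction is a unit segment and contains a lattice point. Joining
points of consecutive rows to the segment from `2 v 0` to `v 0 + v 1` gives unimodular simplices,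
which cover the wedge wherever the path runs. -/
theorem IsTwoTwo.covered_two_mixed {v : Fin 4 → Fin 3 → ℤ} {a : Fin 3 → ℤ} (h : IsTwoTwo v a)
    {l0 l1 l2 l3 : ℝ} (h2 : 0 ≤ l2) (h3 : 0 ≤ l3)
    (hs : l0 + l1 + l2 + l3 = 2) (hl : l2 + l3 ≤ l1) (hr : l1 ≤ 1 - (l2 + l3))
    {x : Fin 3 → ℝ} (hx : ∀ j, x j = l0 * v 0 j + l1 * v 1 j + l2 * v 2 j + l3 * v 3 j) :
    Covered (dil v 2) x := by
  obtain ⟨hv, ha1, ha2, ha3⟩ := h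
  obtain ⟨e, hae, hdet⟩ := exists_adapted_vector hv.isPrimitiveVec ha1 ha2
  have haw : dot3 a (v 3 - v 2) = 0 := by
    rw [dot3_sub] at ha2 ha3 ⊢; linarith
  have hw := eq_combination_of_dot3_eq_zero ha1 ha2 hae hdet haw
  have hq : det3 (v 1 - v 0) (v 3 - v 2) (v 2 - v 0) = -vol v := by
    simp only [vol, det3, Pi.sub_apply]; ring
  rw [hq] at hw
  generalize det3 (v 3 - v 2) e (v 2 - v 0) = p at hw
  have hv0 := hv.1
  obtain ⟨s, Q, hs1, hsQ, hQ1⟩ : ∃ s Q : ℤ, s.natAbs = 1 ∧ -vol v = s * Q ∧ 1 ≤ Q := by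
    rcases le_or_gt 0 (-vol v) with h | h
    · exact ⟨1, -vol v, rfl, by ring, by omega⟩
    · exact ⟨-1, vol v, rfl, by ring, by omega⟩
  have hQR : (1 : ℝ) ≤ Q := by exact_mod_cast hQ1
  obtain ⟨P, hP⟩ : ∃ P : ℝ, (p : ℝ) = P * Q := ⟨p / Q, by field_simp⟩
  have hw' : ∀ j, (v 3 j : ℝ) = v 2 j + P * Q * (v 1 j - v 0 j) + s * Q * e j := by
    intro j
    have h := hw j
    rw [hsQ] at h
    simp only [Pi.sub_apply] at h
    have h' : v 3 j = v 2 j + p * (v 1 j - v 0 j) + s * Q * e j := by linarith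
    rw [← hP]
    exact_mod_cast h'
  have hround : ∀ i : ℤ, 0 ≤ i → i ≤ Q → ∃ m : ℤ, 0 ≤ m - P * i ∧ m - P * i ≤ 1 ∧
      latticePt (fun j => v 0 j + v 2 j + m * (v 1 j - v 0 j) + i * (s * e j)) ∈ dil v 2 := by
    intro i hi hiQ
    have hi' : (0 : ℝ) ≤ i := by exact_mod_cast hi
    have hiQ' : (i : ℝ) ≤ Q := by exact_mod_cast hiQ
    have b1 := Int.le_ceil (P * i)
    have b2 := Int.ceil_lt_add_one (P * i)
    refine ⟨⌈P * i⌉, by linarith, by linarith, ?_⟩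
    refine mem_dil_of (1 - (⌈P * i⌉ - P * i)) (⌈P * i⌉ - P * i) (1 - i / Q) (i / Q) (by linarith)
      (by linarith) ?_ (by positivity) (by ring) fun j => ?_
    · have : (i : ℝ) / Q ≤ 1 := (div_le_one (by linarith)).2 hiQ'
      linarith
    · simp only [latticePt, hw']
      push_cast
      field_simp
      ring
  -- Seen from the bottom edge, `x` projects to the strip between rows `i` and `i + 1` of the
  -- parallelogram.
  obtain ⟨i, hi0, hiQ, hi1, hi2⟩ := exists_strip_index hQ1 h3 (by linarith : l3 ≤ l2 + l3)
  obtain ⟨m, hm0, hm1, hm⟩ := hround i hi0 (by omega)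
  obtain ⟨n, hn0, hn1, hn⟩ := hround (i + 1) (by omega) hiQ
  push_cast at hn0 hn1
  have hR0 : 0 ≤ Q * l3 - (l2 + l3) * i := by linarith
  have hR1 : 0 ≤ (l2 + l3) * (i + 1) - Q * l3 := by linarith
  have f1 := mul_nonneg hR1 hm0
  have f2 := mul_nonneg hR0 hn0
  have f3 := mul_nonneg hR1 (sub_nonneg.2 hm1)
  have f4 := mul_nonneg hR0 (sub_nonneg.2 hn1)
  refine ⟨![fun j => 2 * v 0 j, fun j => v 0 j + v 1 j,
    fun j => v 0 j + v 2 j + m * (v 1 j - v 0 j) + i * (s * e j),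
    fun j => v 0 j + v 2 j + n * (v 1 j - v 0 j) + (i + 1) * (s * e j)], ?_, ?_, ?_⟩
  · refine Eq.trans ?_ hs1
    rw [← Int.natAbs_neg]
    congr 1
    simp only [det3, Pi.sub_apply] at hdet
    simp [vol, det3]
    linear_combination s * hdet
  · rw [tet_eq_dil_one]
    -- The last two weights add up to `l2 + l3`, and the row offsets lie in `[0, 1]`, so the path
    -- contributes between `0` and `l2 + l3` to the `v 1` weight. The bounds on `l1` make the
    -- remaining two weights nonnegative.
    refine mem_dil_of
      (1 - (l2 + l3) - (l1 - (((l2 + l3) * (i + 1) - Q * l3) * (m - P * i) +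
        (Q * l3 - (l2 + l3) * i) * (n - P * (i + 1)))))
      (l1 - (((l2 + l3) * (i + 1) - Q * l3) * (m - P * i) +
        (Q * l3 - (l2 + l3) * i) * (n - P * (i + 1))))
      ((l2 + l3) * (i + 1) - Q * l3) (Q * l3 - (l2 + l3) * i) ?_ ?_ hR1 hR0 (by ring) fun j => ?_
    · linarith
    · linarith
    · simp [hx, hw']
      have : l0 = 2 - l1 - l2 - l3 := by linarith
      rw [this]
      ring
  · refine tet_subset (convex_dil v 2) fun k => ?_
    fin_cases k
    · exact mem_dil_of 2 0 0 0 (by norm_num) le_rfl le_rfl le_rfl (by norm_num)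
        fun j => by simp [latticePt]
    · exact mem_dil_of 1 1 0 0 (by norm_num) (by norm_num) le_rfl le_rfl (by norm_num)
        fun j => by simp [latticePt]
    · exact hm
    · exact hn

/-- With `t = l 2 + l 3`, the cases `l 1 ≤ t` and `1 - t ≤ l 1` are the pyramids over the middle
parallelogram with apex `2 v 0` and `v 0 + v 1`; the wedge between them is the mixed case. -/
theorem IsTwoTwo.covered_two_of_le {v : Fin 4 → Fin 3 → ℤ} {a : Fin 3 → ℤ} (h : IsTwoTwo v a)
    {l : Fin 4 → ℝ} (hl : ∀ i, 0 ≤ l i) (hs : ∑ i, l i = 2) (ht : l 2 + l 3 ≤ 1) (h10 : l 1 ≤ l 0)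
    {x : Fin 3 → ℝ} (hx : ∀ j, x j = ∑ i, l i * v i j) : Covered (dil v 2) x := by
  simp only [Fin.sum_univ_four] at hs hx
  have e0 : l 0 = 2 - l 1 - l 2 - l 3 := by linarith
  have hp : latticePt (v 0 + v 2) ∈ dil v 2 :=
    mem_dil_of 1 0 1 0 (by norm_num) le_rfl (by norm_num) le_rfl (by norm_num)
      fun j => by simp [latticePt]
  have hq : latticePt (v 1 + v 2) ∈ dil v 2 :=
    mem_dil_of 0 1 1 0 le_rfl (by norm_num) (by norm_num) le_rfl (by norm_num)
      fun j => by simp [latticePt]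
  have hr : latticePt (v 0 + v 3) ∈ dil v 2 :=
    mem_dil_of 1 0 0 1 (by norm_num) le_rfl le_rfl (by norm_num) (by norm_num)
      fun j => by simp [latticePt]
  have hsm : latticePt (v 1 + v 2 + (v 0 + v 3) - (v 0 + v 2)) ∈ dil v 2 :=
    mem_dil_of 0 1 0 1 le_rfl (by norm_num) le_rfl (by norm_num) (by norm_num)
      fun j => by simp [latticePt]; ring
  have hv := h.empty.1
  have d1 := h.one
  have d2 := h.two
  have d3 := h.three
  simp only [dot3, Pi.sub_apply] at d1 d2 d3
  rcases le_total (l 1) (l 2 + l 3) with c1 | c1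
  · refine covered_pyramid (convex_dil v 2) (o := v 0 + v 0) ?_ hp hq hr hsm (a := a) ?_ ?_ ?_ ?_
      (τ := l 2 + l 3) (X := l 1) (Y := l 3) ht (hl 1) c1 (hl 3) (by linarith [hl 2]) fun j => ?_
    · exact mem_dil_of 2 0 0 0 (by norm_num) le_rfl le_rfl le_rfl (by norm_num)
        fun j => by simp [latticePt]; ring
    · simp only [dot3, Pi.sub_apply, Pi.add_apply]; linarith
    · simp only [dot3, Pi.sub_apply, Pi.add_apply]; linarith
    · simp only [dot3, Pi.sub_apply, Pi.add_apply]; linarith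
    · have : vol ![v 0 + v 0, v 0 + v 2, v 1 + v 2, v 0 + v 3] = -vol v := by
        simp [vol, det3]; ring
      rw [this]
      exact neg_ne_zero.2 hv
    · simp [hx, e0]; ring
  rcases le_total (l 1) (1 - (l 2 + l 3)) with c2 | c2
  · exact h.covered_two_mixed (hl 2) (hl 3) hs c1 c2 hx
  · refine covered_pyramid (convex_dil v 2) (o := v 0 + v 1) ?_ hp hq hr hsm (a := a) ?_ ?_ ?_ ?_
      (τ := l 2 + l 3) (X := l 1 - (1 - (l 2 + l 3))) (Y := l 3) ht (by linarith) (by linarith)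
      (hl 3) (by linarith [hl 2]) fun j => ?_
    · exact mem_dil_of 1 1 0 0 (by norm_num) (by norm_num) le_rfl le_rfl (by norm_num)
        fun j => by simp [latticePt]
    · simp only [dot3, Pi.sub_apply, Pi.add_apply]; linarith
    · simp only [dot3, Pi.sub_apply, Pi.add_apply]; linarith
    · simp only [dot3, Pi.sub_apply, Pi.add_apply]; linarith
    · have : vol ![v 0 + v 1, v 0 + v 2, v 1 + v 2, v 0 + v 3] = -vol v := by
        simp [vol, det3]; ring
      rw [this]
      exact neg_ne_zero.2 hv
    · simp [hx, e0]; ring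

theorem IsTwoTwo.covered_two {v : Fin 4 → Fin 3 → ℤ} {a : Fin 3 → ℤ} (h : IsTwoTwo v a)
    {x : Fin 3 → ℝ} (hx : x ∈ dil v 2) : Covered (dil v 2) x := by
  have main : ∀ (v : Fin 4 → Fin 3 → ℤ) (a : Fin 3 → ℤ), IsTwoTwo v a → ∀ l : Fin 4 → ℝ,
      (∀ i, 0 ≤ l i) → ∑ i, l i = 2 → l 2 + l 3 ≤ 1 → (∀ j, x j = ∑ i, l i * v i j) →
      Covered (dil v 2) x := by
    intro v a h l hl hs ht hx
    rcases le_total (l 1) (l 0) with c | c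
    · exact h.covered_two_of_le hl hs ht c hx
    · rw [← dil_comp_perm v two_pos (Equiv.swap 0 1)]
      have e2 : Equiv.swap (0 : Fin 4) 1 2 = 2 := by decide
      have e3 : Equiv.swap (0 : Fin 4) 1 3 = 3 := by decide
      refine h.swap_bottom.covered_two_of_le (l := l ∘ Equiv.swap 0 1) (fun i => hl _) ?_ ?_ ?_
        fun j => ?_
      · rw [← hs]; exact Equiv.sum_comp (Equiv.swap 0 1) l
      · simpa [e2, e3] using ht
      · simpa using c
      · rw [hx j]; exact (Equiv.sum_comp (Equiv.swap 0 1) fun i => l i * (v i j : ℝ)).symm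
  obtain ⟨l, hl, hs, hxl⟩ := hx
  rcases le_total (l 2 + l 3) 1 with c | c
  · exact main v a h l hl hs c hxl
  · rw [← dil_comp_perm v two_pos exchangeLevels]
    obtain ⟨-, -, e2, e3⟩ := exchangeLevels_apply
    refine main _ _ h.exchange (l ∘ exchangeLevels) (fun i => hl _) ?_ ?_ fun j => ?_
    · rw [← hs]; exact Equiv.sum_comp exchangeLevels l
    · simp only [Function.comp_apply, e2, e3]
      rw [Fin.sum_univ_four] at hs
      linarith
    · rw [hxl j]; exact (Equiv.sum_comp exchangeLevels fun i => l i * (v i j : ℝ)).symm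

/-- Weights at most one force the height `l 2 + l 3` to be at least `1`. This region lies in the
pyramid over the whole slice of `3T` at height `1`, with apex `v 1 + v 2 + v 3` at height `2`; the
bound `3 / 2` gives `0 ≤ X`. The form is `-a` because the apex is above the base, and `X` is halved
because that side is `2 (v 1 - v 0)`. -/
theorem IsTwoTwo.covered_three_of_le {v : Fin 4 → Fin 3 → ℤ} {a : Fin 3 → ℤ} (h : IsTwoTwo v a)
    {l : Fin 4 → ℝ} (hl1 : ∀ i, l i ≤ 1) (hs : ∑ i, l i = 3)
    (ht : l 2 + l 3 ≤ 3 / 2) {x : Fin 3 → ℝ} (hx : ∀ j, x j = ∑ i, l i * v i j) :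
    Covered (dil v 3) x := by
  simp only [Fin.sum_univ_four] at hs hx
  have e0 : l 0 = 3 - l 1 - l 2 - l 3 := by linarith
  have hv := h.empty.1
  have d1 := h.one
  have d2 := h.two
  have d3 := h.three
  simp only [dot3, Pi.sub_apply] at d1 d2 d3
  have := hl1 0
  have := hl1 1
  have := hl1 2
  have := hl1 3
  refine covered_pyramid (convex_dil v 3) (o := v 1 + v 2 + v 3) (p := v 0 + v 0 + v 2)
    (q := v 1 + v 1 + v 2) (r := v 0 + v 0 + v 3) ?_ ?_ ?_ ?_ ?_ (a := -a) ?_ ?_ ?_ ?_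
    (τ := 1 - (l 2 + l 3 - 1)) (X := (l 1 - (l 2 + l 3 - 1)) / 2) (Y := l 3 - (l 2 + l 3 - 1))
    (by linarith) (by linarith) (by linarith) (by linarith) (by linarith) fun j => ?_
  · exact mem_dil_of 0 1 1 1 (by norm_num) (by norm_num) (by norm_num) (by norm_num) (by norm_num)
      fun j => by simp [latticePt]
  · exact mem_dil_of 2 0 1 0 (by norm_num) (by norm_num) (by norm_num) (by norm_num) (by norm_num)
      fun j => by simp [latticePt]; ring
  · exact mem_dil_of 0 2 1 0 (by norm_num) (by norm_num) (by norm_num) (by norm_num) (by norm_num)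
      fun j => by simp [latticePt]; ring
  · exact mem_dil_of 2 0 0 1 (by norm_num) (by norm_num) (by norm_num) (by norm_num) (by norm_num)
      fun j => by simp [latticePt]; ring
  · exact mem_dil_of 0 2 0 1 (by norm_num) (by norm_num) (by norm_num) (by norm_num) (by norm_num)
      fun j => by simp [latticePt]; ring
  · simp only [dot3, Pi.sub_apply, Pi.add_apply, Pi.neg_apply]; linarith
  · simp only [dot3, Pi.sub_apply, Pi.add_apply, Pi.neg_apply]; linarith
  · simp only [dot3, Pi.sub_apply, Pi.add_apply, Pi.neg_apply]; linarith
  · have : vol ![v 1 + v 2 + v 3, v 0 + v 0 + v 2, v 1 + v 1 + v 2, v 0 + v 0 + v 3] =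
        2 * vol v := by
      simp [vol, det3]; ring
    rw [this]
    exact mul_ne_zero two_ne_zero hv
  · simp [hx, e0]; ring

theorem Covered.translate {v : Fin 4 → Fin 3 → ℤ} {k : ℝ} {x : Fin 3 → ℝ} (i : Fin 4)
    (h : Covered (dil v k) (fun j => x j - v i j)) : Covered (dil v (k + 1)) x := by
  obtain ⟨w, hw, hxw, hwK⟩ := h
  refine ⟨fun m => w m + v i, ?_, ?_, ?_⟩
  · rw [← hw]
    simp [vol]
  · obtain ⟨l, hl, hs, hxl⟩ := mem_tet.1 hxw
    refine mem_tet.2 ⟨l, hl, hs, fun j => ?_⟩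
    have := hxl j
    simp only [Fin.sum_univ_four, Pi.add_apply] at hs this ⊢
    push_cast
    linear_combination this - (v i j : ℝ) * hs
  · refine tet_subset (convex_dil v _) fun m => ?_
    obtain ⟨l, hl, hs, hml⟩ := hwK (latticePt_mem_tet w m)
    refine ⟨l + Pi.single i 1, fun c => ?_, ?_, fun j => ?_⟩
    · have h1 := hl c
      have h2 : (0 : ℝ) ≤ (Pi.single i 1 : Fin 4 → ℝ) c := by
        by_cases hc : c = i
        · subst hc; simp
        · simp [hc]
      simpa using add_nonneg h1 h2
    · simp [Finset.sum_add_distrib, hs]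
    · have := hml j
      simp only [latticePt] at this
      simp [add_mul, Finset.sum_add_distrib, ← this, latticePt, Pi.single_apply]

theorem covered_translate_of_one_le {v : Fin 4 → Fin 3 → ℤ} {k : ℝ}
    (h : ∀ x ∈ dil v k, Covered (dil v k) x) {l : Fin 4 → ℝ} (hl : ∀ i, 0 ≤ l i)
    (hs : ∑ i, l i = k + 1) {i : Fin 4} (hi : 1 ≤ l i) {x : Fin 3 → ℝ}
    (hx : ∀ j, x j = ∑ i, l i * v i j) : Covered (dil v (k + 1)) x := by
  refine Covered.translate i (h _ ⟨l - Pi.single i 1, fun c => ?_, ?_, fun j => ?_⟩)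
  · by_cases hc : c = i
    · subst hc; simpa using hi
    · simpa [hc] using hl c
  · simp [Finset.sum_sub_distrib, hs]
  · simp [sub_mul, Finset.sum_sub_distrib, hx, Pi.single_apply]

theorem IsTwoTwo.covered_three {v : Fin 4 → Fin 3 → ℤ} {a : Fin 3 → ℤ} (h : IsTwoTwo v a)
    {x : Fin 3 → ℝ} (hx : x ∈ dil v 3) : Covered (dil v 3) x := by
  obtain ⟨l, hl, hs, hxl⟩ := hx
  by_cases h1 : ∃ i, 1 ≤ l i
  · obtain ⟨i, hi⟩ := h1
    have := covered_translate_of_one_le (fun x hx => h.covered_two hx) hl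
      (by rw [hs]; norm_num) hi hxl
    norm_num at this
    exact this
  push Not at h1
  rcases le_total (l 2 + l 3) (3 / 2) with c | c
  · exact h.covered_three_of_le (fun i => (h1 i).le) hs c hxl
  · rw [← dil_comp_perm v three_pos exchangeLevels]
    obtain ⟨-, -, e2, e3⟩ := exchangeLevels_apply
    refine h.exchange.covered_three_of_le (l := l ∘ exchangeLevels) (fun i => (h1 _).le) ?_ ?_
      fun j => ?_
    · rw [← hs]; exact Equiv.sum_comp exchangeLevels l
    · simp only [Function.comp_apply, e2, e3]
      rw [Fin.sum_univ_four] at hs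
      linarith
    · rw [hxl j]; exact (Equiv.sum_comp exchangeLevels fun i => l i * (v i j : ℝ)).symm

theorem IsTwoTwo.covered_dil {v : Fin 4 → Fin 3 → ℤ} {a : Fin 3 → ℤ} (h : IsTwoTwo v a) {k : ℕ}
    (hk : 2 ≤ k) : ∀ x ∈ dil v k, Covered (dil v k) x := by
  induction k, hk using Nat.le_induction with
  | base => exact fun x hx => h.covered_two hx
  | succ k hk ih =>
    intro x hx
    rcases hk.eq_or_lt with rfl | hk3
    · norm_num at hx ⊢
      exact h.covered_three hx
    · obtain ⟨l, hl, hs, hxl⟩ := hx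
      push_cast at hs ⊢
      obtain ⟨i, hi⟩ : ∃ i, 1 ≤ l i := by
        by_contra! hlt
        simp only [Fin.sum_univ_four] at hs
        have : (3 : ℝ) ≤ k := by exact_mod_cast hk3
        linarith [hlt 0, hlt 1, hlt 2, hlt 3]
      exact covered_translate_of_one_le ih hl hs hi hxl

/-! ### Empty tetrahedra of width one -/

theorem covered_dil_of_natAbs_vol_eq_one {v : Fin 4 → Fin 3 → ℤ} (hv : IsEmptyTet v)
    (h1 : (vol v).natAbs = 1) {k : ℕ} (hk : 2 ≤ k) : ∀ x ∈ dil v k, Covered (dil v k) x := by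
  have hvv : vol v * vol v = 1 := by
    rcases Int.natAbs_eq_iff.1 h1 with h | h <;> rw [h] <;> rfl
  -- The form vanishes along both opposite edges `v 0 v 1` and `v 2 v 3`; volume `±1` puts these
  -- edges at lattice distance one.
  refine IsTwoTwo.covered_dil (v := v)
    (a := fun i => -vol v * cross3 (v 1 - v 0) (v 3 - v 2) i) ⟨hv, ?_, ?_, ?_⟩ hk
  · simp [dot3, cross3]; ring
  · rw [← hvv]; simp [dot3, cross3]; simp [vol, det3]; ring
  · rw [← hvv]; simp [dot3, cross3]; simp [vol, det3]; ring

theorem covered_dil_of_levels {v : Fin 4 → Fin 3 → ℤ} (hv : IsEmptyTet v) {a : Fin 3 → ℤ}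
    {c : ℤ} (ha : ∃ f, dot3 a f = 1) (hlev : ∀ i, dot3 a (v i) = c ∨ dot3 a (v i) = c + 1)
    {k : ℕ} (hk : 2 ≤ k) : ∀ x ∈ dil v k, Covered (dil v k) x := by
  have hkR : (0 : ℝ) < k := by
    have : 0 < k := by omega
    exact_mod_cast this
  obtain ⟨f, hf⟩ := ha
  have unimod : ∀ (σ : Equiv.Perm (Fin 4)) (b : Fin 3 → ℤ),
      dot3 b (v (σ 1)) - dot3 b (v (σ 0)) = 0 → dot3 b (v (σ 2)) - dot3 b (v (σ 0)) = 0 →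
      dot3 b (v (σ 3)) - dot3 b (v (σ 0)) = 1 → ∀ x ∈ dil v k, Covered (dil v k) x := by
    intro σ b h1 h2 h3
    apply covered_dil_of_natAbs_vol_eq_one hv _ hk
    rw [← natAbs_vol_comp_perm v σ]
    simp only [← dot3_sub] at h1 h2 h3
    exact (hv.comp_perm σ).natAbs_vol_eq_one_of_facet h1 h2 h3
  have twotwo : ∀ (σ : Equiv.Perm (Fin 4)) (b : Fin 3 → ℤ),
      dot3 b (v (σ 1)) - dot3 b (v (σ 0)) = 0 → dot3 b (v (σ 2)) - dot3 b (v (σ 0)) = 1 →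
      dot3 b (v (σ 3)) - dot3 b (v (σ 0)) = 1 → ∀ x ∈ dil v k, Covered (dil v k) x := by
    intro σ b h1 h2 h3
    rw [← dil_comp_perm v hkR σ]
    simp only [← dot3_sub] at h1 h2 h3
    exact IsTwoTwo.covered_dil ⟨hv.comp_perm σ, h1, h2, h3⟩ hk
  have flat : ¬ (dot3 a (v 1) = dot3 a (v 0) ∧ dot3 a (v 2) = dot3 a (v 0) ∧
      dot3 a (v 3) = dot3 a (v 0)) := by
    rintro ⟨h1, h2, h3⟩
    apply hv.1
    apply vol_eq_zero_of_coplanar hf <;> rw [dot3_sub] <;> linarith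
  have s02 : Equiv.swap (0 : Fin 4) 2 0 = 2 ∧ Equiv.swap (0 : Fin 4) 2 1 = 1 ∧
    Equiv.swap (0 : Fin 4) 2 2 = 0 ∧ Equiv.swap (0 : Fin 4) 2 3 = 3 := by decide
  have s03 : Equiv.swap (0 : Fin 4) 3 0 = 3 ∧ Equiv.swap (0 : Fin 4) 3 1 = 1 ∧
    Equiv.swap (0 : Fin 4) 3 2 = 2 ∧ Equiv.swap (0 : Fin 4) 3 3 = 0 := by decide
  have s12 : Equiv.swap (1 : Fin 4) 2 0 = 0 ∧ Equiv.swap (1 : Fin 4) 2 1 = 2 ∧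
    Equiv.swap (1 : Fin 4) 2 2 = 1 ∧ Equiv.swap (1 : Fin 4) 2 3 = 3 := by decide
  have s13 : Equiv.swap (1 : Fin 4) 3 0 = 0 ∧ Equiv.swap (1 : Fin 4) 3 1 = 3 ∧
    Equiv.swap (1 : Fin 4) 3 2 = 2 ∧ Equiv.swap (1 : Fin 4) 3 3 = 1 := by decide
  have s23 : Equiv.swap (2 : Fin 4) 3 0 = 0 ∧ Equiv.swap (2 : Fin 4) 3 1 = 1 ∧
    Equiv.swap (2 : Fin 4) 3 2 = 3 ∧ Equiv.swap (2 : Fin 4) 3 3 = 2 := by decide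
  have facet : ∀ (σ : Equiv.Perm (Fin 4)), dot3 a (v (σ 1)) = dot3 a (v (σ 0)) →
      dot3 a (v (σ 2)) = dot3 a (v (σ 0)) →
      (dot3 a (v (σ 3)) = dot3 a (v (σ 0)) + 1 ∨ dot3 a (v (σ 3)) = dot3 a (v (σ 0)) - 1) →
      ∀ x ∈ dil v k, Covered (dil v k) x := by
    rintro σ h1 h2 (h3 | h3)
    · exact unimod σ a (by omega) (by omega) (by omega)
    · exact unimod σ (-a) (by simp only [dot3_neg_left]; omega)
        (by simp only [dot3_neg_left]; omega) (by simp only [dot3_neg_left]; omega)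
  have edges : ∀ (σ : Equiv.Perm (Fin 4)), dot3 a (v (σ 1)) = dot3 a (v (σ 0)) →
      dot3 a (v (σ 3)) = dot3 a (v (σ 2)) →
      (dot3 a (v (σ 2)) = dot3 a (v (σ 0)) + 1 ∨ dot3 a (v (σ 2)) = dot3 a (v (σ 0)) - 1) →
      ∀ x ∈ dil v k, Covered (dil v k) x := by
    rintro σ h1 h2 (h3 | h3)
    · exact twotwo σ a (by omega) (by omega) (by omega)
    · exact twotwo σ (-a) (by simp only [dot3_neg_left]; omega)
        (by simp only [dot3_neg_left]; omega) (by simp only [dot3_neg_left]; omega)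
  obtain ⟨p0, p1, p2, p3⟩ := s02
  obtain ⟨q0, q1, q2, q3⟩ := s03
  obtain ⟨r0, r1, r2, r3⟩ := s12
  obtain ⟨t0, t1, t2, t3⟩ := s13
  obtain ⟨u0, u1, u2, u3⟩ := s23
  have H0 := hlev 0
  have H1 := hlev 1
  have H2 := hlev 2
  have H3 := hlev 3
  by_cases g1 : dot3 a (v 1) = dot3 a (v 0) <;> by_cases g2 : dot3 a (v 2) = dot3 a (v 0) <;>
    by_cases g3 : dot3 a (v 3) = dot3 a (v 0)
  · exact absurd ⟨g1, g2, g3⟩ flat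
  · exact facet 1 g1 g2 (by simp only [Equiv.Perm.coe_one, id]; omega)
  · exact facet (Equiv.swap 2 3) (by rw [u0, u1]; omega) (by rw [u0, u2]; omega)
      (by rw [u0, u3]; omega)
  · exact edges 1 g1 (by simp only [Equiv.Perm.coe_one, id]; omega)
      (by simp only [Equiv.Perm.coe_one, id]; omega)
  · exact facet (Equiv.swap 1 3) (by rw [t0, t1]; omega) (by rw [t0, t2]; omega)
      (by rw [t0, t3]; omega)
  · exact edges (Equiv.swap 1 2) (by rw [r0, r1]; omega) (by rw [r2, r3]; omega)
      (by rw [r0, r2]; omega)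
  · exact edges (Equiv.swap 1 3) (by rw [t0, t1]; omega) (by rw [t2, t3]; omega)
      (by rw [t0, t2]; omega)
  · exact facet (Equiv.swap 0 3) (by rw [q0, q1]; omega) (by rw [q0, q2]; omega)
      (by rw [q0, q3]; omega)

/-! ### White's theorem: empty tetrahedra have width one -/

theorem exists_ceil_div {q b : ℤ} (hq : 1 ≤ q) (hb : 1 ≤ b) :
    ∃ m : ℤ, 1 ≤ m ∧ (m - 1) * b < q ∧ q ≤ m * b := by
  refine ⟨(q - 1) / b + 1, ?_, ?_, ?_⟩
  · have : 0 ≤ (q - 1) / b := Int.ediv_nonneg (by omega) (by omega)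
    omega
  · have := Int.ediv_mul_le (q - 1) (show b ≠ 0 by omega)
    rw [add_sub_cancel_right]
    omega
  · have := Int.lt_ediv_add_one_mul_self (q - 1) (show 0 < b by omega)
    omega

/-- With `a = q - b₁`, the hypothesis says that the jumps of `⌊k a / q⌋` are those of `⌊k b₂ / q⌋`
and `⌊k b₃ / q⌋` together. If `b₃ ≥ 2`, the first jump of the `b₃` sequence falls strictly between
two jumps of the `b₂` sequence, which packs three jumps of the `a` sequence too tightly, or else
happens so near `q` that `b₃ < 2`. -/
theorem floor_sum_ordered {q b₁ b₂ b₃ : ℤ} (hsum : b₁ + b₂ + b₃ = q + 1) (h12 : b₂ ≤ b₁)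
    (h23 : b₃ ≤ b₂) (h1 : ∀ k, 1 ≤ k → k < q → ¬ q ∣ k * b₁)
    (hfl : ∀ k, 1 ≤ k → k < q → k * b₁ / q + k * b₂ / q + k * b₃ / q = k - 1) : b₃ ≤ 1 := by
  by_contra! hb3
  have hq5 : 5 ≤ q := by omega
  have hq : 0 < q := by omega
  obtain ⟨a, ha⟩ : ∃ a, a = q - b₁ := ⟨_, rfl⟩
  have hg : ∀ k, 0 ≤ k → k < q → k * a / q = k * b₂ / q + k * b₃ / q := by
    intro k hk hkq
    rcases hk.eq_or_lt with rfl | hk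
    · simp
    have e1 := hfl k (by omega) hkq
    have e2 : k * a / q = k - k * b₁ / q - 1 := by
      have hr0 := Int.emod_nonneg (k * b₁) hq.ne'
      have hr1 := Int.emod_lt_of_pos (k * b₁) hq
      have hr2 : k * b₁ % q ≠ 0 := fun h => h1 k (by omega) hkq (Int.dvd_of_emod_eq_zero h)
      have hr3 := Int.mul_ediv_add_emod (k * b₁) q
      have hka : k * a = q * (k - k * b₁ / q) - k * b₁ % q := by
        rw [ha]; linear_combination hr3
      have hr4 : 0 < k * b₁ % q := lt_of_le_of_ne hr0 (Ne.symm hr2)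
      rw [Int.ediv_eq_iff_of_pos hq]
      constructor <;> nlinarith
    omega
  -- Otherwise all three floors vanish at `k = 2`, where their sum must be `1`.
  have h2a : 2 * a < q := by
    have e := hfl 2 (by omega) (by omega)
    have hn := h1 2 (by omega) (by omega)
    by_contra! hle
    have hlt : 2 * b₁ < q := by
      rcases (show 2 * b₁ ≤ q by omega).eq_or_lt with h | h
      · exact absurd (by rw [h]) hn
      · exact h
    rw [Int.ediv_eq_zero_of_lt (by omega) hlt, Int.ediv_eq_zero_of_lt (by omega) (by omega),
      Int.ediv_eq_zero_of_lt (by omega) (by omega)] at e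
    omega
  -- `K` is the first jump of the `a` sequence; that jump comes from `b₂`, as `b₂ ≥ b₃`.
  obtain ⟨K, hK1, hKlt, hKle⟩ := exists_ceil_div (show 1 ≤ q by omega) (show 1 ≤ a by omega)
  have hKq : K < q := by
    have : (K - 1) * a < (q - 2) * a := by nlinarith
    have := lt_of_mul_lt_mul_right this (by omega)
    omega
  have hgK := hg K (by omega) hKq
  have hgK1 : K * a / q = 1 := by
    rw [Int.ediv_eq_iff_of_pos hq]
    constructor <;> nlinarith
  have hKb : K * b₃ ≤ K * b₂ := mul_le_mul_of_nonneg_left h23 (by omega)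
  have hK32 := Int.ediv_le_ediv hq hKb
  have hK30 : 0 ≤ K * b₃ / q := Int.ediv_nonneg (mul_nonneg (by omega) (by omega)) hq.le
  have hK3 : K * b₃ < q := by
    have := (Int.ediv_lt_iff_lt_mul hq).1 (show K * b₃ / q < 1 by omega)
    omega
  have hK2 : q ≤ K * b₂ := by
    have := (Int.le_ediv_iff_mul_le hq).1 (show 1 ≤ K * b₂ / q by omega)
    omega
  obtain ⟨m, hm1, hmlt, hmle⟩ := exists_ceil_div (show 1 ≤ q by omega) (show 1 ≤ b₃ by omega)
  have hmq : m < q := by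
    have : (m - 1) * b₃ < (q - 2) * b₃ := by nlinarith
    have := lt_of_mul_lt_mul_right this (by omega)
    omega
  have hKm : K < m := lt_of_mul_lt_mul_right (hK3.trans_le hmle) (by omega)
  obtain ⟨s, hs⟩ : ∃ s, s = m * b₂ / q := ⟨_, rfl⟩
  have hf3m : 1 ≤ m * b₃ / q := (Int.le_ediv_iff_mul_le hq).2 (by omega)
  have hf3m' : (m - 1) * b₃ / q = 0 :=
    Int.ediv_eq_zero_of_lt (mul_nonneg (by omega) (by omega)) hmlt
  -- `m` is the first jump of the `b₃` sequence. A single step of `a` allows only one jump, so the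
  -- `b₂` sequence does not jump at `m`.
  have hstep : m * a / q ≤ (m - 1) * a / q + 1 := by
    have hlt := Int.lt_ediv_add_one_mul_self ((m - 1) * a) hq
    have : m * a / q < (m - 1) * a / q + 2 := by
      rw [Int.ediv_lt_iff_lt_mul hq]
      nlinarith
    omega
  have hgm := hg m (by omega) hmq
  have hgm' := hg (m - 1) (by omega) (by omega)
  have hs1 : 1 ≤ s := by
    rw [hs, Int.le_ediv_iff_mul_le hq]
    nlinarith
  have hsle : s * q ≤ (m - 1) * b₂ := by
    rw [← Int.le_ediv_iff_mul_le hq]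
    omega
  have hslt : m * b₂ < (s + 1) * q := by
    rw [← Int.ediv_lt_iff_lt_mul hq]
    omega
  -- `k₁ < m < k₂` are the neighbouring jumps of the `b₂` sequence, to the values `s` and `s + 1`.
  obtain ⟨k₁, hk1, hk1lt, hk1le⟩ :=
    exists_ceil_div (show 1 ≤ s * q by nlinarith) (show 1 ≤ b₂ by omega)
  obtain ⟨k₂, hk2, hk2lt, hk2le⟩ :=
    exists_ceil_div (show 1 ≤ (s + 1) * q by nlinarith) (show 1 ≤ b₂ by omega)
  have hk1m : k₁ - 1 < m - 1 := lt_of_mul_lt_mul_right (hk1lt.trans_le hsle) (by omega)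
  have hmk2 : m < k₂ := lt_of_mul_lt_mul_right (hslt.trans_le hk2le) (by omega)
  have hgap : k₂ - 1 - k₁ < K := by
    have : (k₂ - 1 - k₁) * b₂ < K * b₂ := by nlinarith
    exact lt_of_mul_lt_mul_right this (by omega)
  -- If `k₂ < q`, the `a` sequence gains at least three from `k₁ - 1` to `k₂`, so `2q < (k₂ - k₁ +
  -- 1) a ≤ (K + 1) a < q + 2a`, against `2a < q`. If `k₂ ≥ q`, then `q - m < K`, so both `(m - 1)
  -- b₃` and `(q - m + 1) b₃` are below `q`; hence `q b₃ < 2q`.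
  rcases lt_or_ge k₂ q with hc | hc
  · have g2 := hg k₂ (by omega) hc
    have g1 := hg (k₁ - 1) (by omega) (by omega)
    have e1 : s + 1 ≤ k₂ * b₂ / q := (Int.le_ediv_iff_mul_le hq).2 hk2le
    have e2 : 1 ≤ k₂ * b₃ / q := by
      rw [Int.le_ediv_iff_mul_le hq]
      have := mul_le_mul_of_nonneg_right hmk2.le (show 0 ≤ b₃ by omega)
      linarith
    have e3 : (k₁ - 1) * b₂ / q < s := (Int.ediv_lt_iff_lt_mul hq).2 hk1lt
    have e4 : (k₁ - 1) * b₃ / q < 1 := by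
      rw [Int.ediv_lt_iff_lt_mul hq]
      have := mul_le_mul_of_nonneg_right hk1m.le (show 0 ≤ b₃ by omega)
      linarith
    have e5 := (Int.le_ediv_iff_mul_le hq).1 (show s + 2 ≤ k₂ * a / q by omega)
    have e6 := (Int.ediv_lt_iff_lt_mul hq).1 (show (k₁ - 1) * a / q < s by omega)
    have := mul_le_mul_of_nonneg_right (show k₂ - k₁ + 1 ≤ K + 1 by omega) (show 0 ≤ a by omega)
    linarith
  · have hsb : b₂ ≤ s + 1 := by
      have h3 : (b₂ - 1) * q < (s + 1) * q := by
        have := mul_le_mul_of_nonneg_right (show q - 1 ≤ k₂ - 1 by omega) (show 0 ≤ b₂ by omega)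
        linarith
      have := lt_of_mul_lt_mul_right h3 hq.le
      omega
    have hlt : (q - m) * b₂ < q := by
      have := mul_le_mul_of_nonneg_right (show b₂ - 1 ≤ s by omega) hq.le
      linarith
    have hqm : q - m < K := lt_of_mul_lt_mul_right (hlt.trans_le hK2) (by omega)
    have := mul_le_mul_of_nonneg_right (show q - m + 1 ≤ K by omega) (show 0 ≤ b₃ by omega)
    have := mul_le_mul_of_nonneg_right (show 2 ≤ b₃ by omega) hq.le
    linarith

theorem exists_eq_one_of_floor_sum {q b₁ b₂ b₃ : ℤ} (hsum : b₁ + b₂ + b₃ = q + 1)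
    (p1 : 1 ≤ b₁) (p2 : 1 ≤ b₂) (p3 : 1 ≤ b₃) (h1 : ∀ k, 1 ≤ k → k < q → ¬ q ∣ k * b₁)
    (h2 : ∀ k, 1 ≤ k → k < q → ¬ q ∣ k * b₂) (h3 : ∀ k, 1 ≤ k → k < q → ¬ q ∣ k * b₃)
    (hfl : ∀ k, 1 ≤ k → k < q → k * b₁ / q + k * b₂ / q + k * b₃ / q = k - 1) :
    b₁ = 1 ∨ b₂ = 1 ∨ b₃ = 1 := by
  rcases le_total b₁ b₂ with h12 | h12 <;> rcases le_total b₂ b₃ with h23 | h23 <;>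
    rcases le_total b₁ b₃ with h13 | h13
  · have := floor_sum_ordered (q := q) (by omega) h23 h12 h3
      (fun k a b => by have := hfl k a b; omega)
    omega
  · have := floor_sum_ordered (q := q) (by omega) h23 h12 h3
      (fun k a b => by have := hfl k a b; omega)
    omega
  · have := floor_sum_ordered (q := q) (by omega) h23 h13 h2
      (fun k a b => by have := hfl k a b; omega)
    omega
  · have := floor_sum_ordered (q := q) (by omega) h12 h13 h2
      (fun k a b => by have := hfl k a b; omega)
    omega
  · have := floor_sum_ordered (q := q) (by omega) h13 h12 h3
      (fun k a b => by have := hfl k a b; omega)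
    omega
  · have := floor_sum_ordered (q := q) (by omega) h13 h23 h1
      (fun k a b => by have := hfl k a b; omega)
    omega
  · have := floor_sum_ordered (q := q) (by omega) h12 h23 h1
      (fun k a b => by have := hfl k a b; omega)
    omega
  · have := floor_sum_ordered (q := q) (by omega) h12 h23 h1
      (fun k a b => by have := hfl k a b; omega)
    omega

/-- If all the multiples of `(A, B, 1)` modulo `q` have large residues, then two of the four
barycentric characters of an empty tetrahedron are opposite. -/
theorem residues_opposite {q A B : ℤ} (hA0 : 0 ≤ A) (hAq : A < q) (hB0 : 0 ≤ B) (hBq : B < q)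
    (h : ∀ k, 1 ≤ k → k < q → q < k * A % q + k * B % q + k) :
    A = q - 1 ∨ B = q - 1 ∨ A + B = q := by
  have hq : 0 < q := by omega
  rcases (show 1 ≤ q by omega).eq_or_lt with h1 | hq1
  · left; omega
  have compl : ∀ k C : ℤ, k * C % q + (q - k) * C % q = 0 ∨
      k * C % q + (q - k) * C % q = q := by
    intro k C
    have a0 := Int.emod_nonneg (k * C) hq.ne'
    have a1 := Int.emod_lt_of_pos (k * C) hq
    have b0 := Int.emod_nonneg ((q - k) * C) hq.ne'
    have b1 := Int.emod_lt_of_pos ((q - k) * C) hq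
    obtain ⟨c, hc⟩ : q ∣ k * C % q + (q - k) * C % q := by
      apply Int.dvd_of_emod_eq_zero
      rw [← Int.add_emod, show k * C + (q - k) * C = q * C by ring, Int.mul_emod_right]
    have c0 : 0 ≤ c := by nlinarith
    have c1 : c < 2 := by nlinarith
    rcases (show c = 0 ∨ c = 1 by omega) with rfl | rfl
    · left; omega
    · right; omega
  -- Applying the hypothesis to both `k` and `q - k` excludes zero residues and gives the upper
  -- bound.
  have key : ∀ k, 1 ≤ k → k < q → k * A % q ≠ 0 ∧ k * B % q ≠ 0 ∧
      k * A % q + k * B % q + k < 2 * q := by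
    intro k hk hkq
    have e1 := h k hk hkq
    have e2 := h (q - k) (by omega) (by omega)
    have a1 := Int.emod_lt_of_pos ((q - k) * A) hq
    have b1 := Int.emod_lt_of_pos ((q - k) * B) hq
    rcases compl k A with cA | cA <;> rcases compl k B with cB | cB <;> omega
  have hAB : q < A + B + 1 := by
    have := h 1 le_rfl hq1
    rwa [one_mul, one_mul, Int.emod_eq_of_lt hA0 hAq, Int.emod_eq_of_lt hB0 hBq] at this
  have divA : ∀ k C : ℤ, k * C % q ≠ 0 → k * (q - C) / q = k - k * C / q - 1 := by
    intro k C hC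
    have a0 := Int.emod_nonneg (k * C) hq.ne'
    have a1 := Int.emod_lt_of_pos (k * C) hq
    have a2 := Int.mul_ediv_add_emod (k * C) q
    have a3 : k * (q - C) = q * (k - k * C / q) - k * C % q := by linear_combination a2
    have a4 : 0 < k * C % q := lt_of_le_of_ne a0 (Ne.symm hC)
    rw [Int.ediv_eq_iff_of_pos hq]
    constructor <;> nlinarith
  have ndvd : ∀ k C : ℤ, k * C % q ≠ 0 → ¬ q ∣ k * (q - C) := by
    intro k C hC hd
    apply hC
    apply Int.emod_eq_zero_of_dvd
    have : k * C = q * k - k * (q - C) := by ring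
    rw [this]
    exact dvd_sub (dvd_mul_right _ _) hd
  have hb3 : ∀ k, 1 ≤ k → k < q → k * (A + B + 1 - q) =
      q * (k * A / q + k * B / q - k + 1) + (k * A % q + k * B % q + k - q) := by
    intro k _ _
    have a2 := Int.mul_ediv_add_emod (k * A) q
    have b2 := Int.mul_ediv_add_emod (k * B) q
    linear_combination -a2 - b2
  have ndvd3 : ∀ k, 1 ≤ k → k < q → ¬ q ∣ k * (A + B + 1 - q) := by
    intro k hk hkq hd
    rw [hb3 k hk hkq, dvd_add_right (dvd_mul_right _ _)] at hd
    have := Int.le_of_dvd (by have := h k hk hkq; omega) hd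
    have := (key k hk hkq).2.2
    omega
  have hfl : ∀ k, 1 ≤ k → k < q →
      k * (q - A) / q + k * (q - B) / q + k * (A + B + 1 - q) / q = k - 1 := by
    intro k hk hkq
    rw [divA k A (key k hk hkq).1, divA k B (key k hk hkq).2.1]
    have : k * (A + B + 1 - q) / q = k * A / q + k * B / q - k + 1 := by
      have e1 := h k hk hkq
      have e2 := (key k hk hkq).2.2
      rw [Int.ediv_eq_iff_of_pos hq, hb3 k hk hkq]
      constructor <;> nlinarith
    omega
  -- These values turn the residue bounds `q < · < 2q` into the exact floor identity.
  rcases exists_eq_one_of_floor_sum (q := q) (b₁ := q - A) (b₂ := q - B) (b₃ := A + B + 1 - q)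
    (by ring) (by omega) (by omega) (by omega)
    (fun k hk hkq => ndvd k A (key k hk hkq).1) (fun k hk hkq => ndvd k B (key k hk hkq).2.1)
    ndvd3 hfl with r | r | r <;> omega

theorem exists_primitive_factor {n : Fin 3 → ℤ} (hn : ∃ i, n i ≠ 0) :
    ∃ (m : ℤ) (a g : Fin 3 → ℤ), (∀ i, n i = m * a i) ∧ dot3 a g = 1 := by
  obtain ⟨m, hm⟩ := (IsPrincipalIdealRing.principal (Ideal.span (Set.range n))).principal
  have hdvd : ∀ i, m ∣ n i := fun i => by
    have h : n i ∈ Ideal.span (Set.range n) := Ideal.subset_span (Set.mem_range_self i)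
    rw [hm] at h
    exact Ideal.mem_span_singleton.1 h
  choose a ha using hdvd
  have h1 : m ∈ Ideal.span (Set.range n) := by
    rw [hm]
    exact Ideal.mem_span_singleton_self m
  obtain ⟨c, hc⟩ := Ideal.mem_span_range_iff_exists_fun.1 h1
  refine ⟨m, a, c, ha, ?_⟩
  have hm0 : m ≠ 0 := by
    rintro rfl
    obtain ⟨i, hi⟩ := hn
    exact hi (by rw [ha, zero_mul])
  rw [Fin.sum_univ_three, ha, ha, ha] at hc
  apply mul_left_cancel₀ hm0
  rw [dot3]
  linear_combination hc

/-- The facet spanned by the first three vertices of an empty tetrahedron is unimodular. -/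
theorem IsEmptyTet.exists_completion {v : Fin 4 → Fin 3 → ℤ} (hv : IsEmptyTet v) :
    ∃ g, det3 (v 1 - v 0) (v 2 - v 0) g = 1 := by
  have hne : ∃ i, cross3 (v 1 - v 0) (v 2 - v 0) i ≠ 0 := by
    by_contra! h
    have h0 := h 0
    have h1 := h 1
    have h2 := h 2
    apply hv.1
    simp only [cross3, Matrix.cons_val_zero, Matrix.cons_val_one, Matrix.cons_val,
      Pi.sub_apply] at h0 h1 h2
    simp only [vol, det3, Pi.sub_apply]
    linear_combination (v 3 0 - v 0 0) * h0 + (v 3 1 - v 0 1) * h1 + (v 3 2 - v 0 2) * h2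
  obtain ⟨m, a, g, hn, hag⟩ := exists_primitive_factor hne
  have hdet : ∀ z, det3 (v 1 - v 0) (v 2 - v 0) z = m * dot3 a z := by
    intro z
    have h0 := hn 0
    have h1 := hn 1
    have h2 := hn 2
    simp only [cross3, Matrix.cons_val_zero, Matrix.cons_val_one, Matrix.cons_val,
      Pi.sub_apply] at h0 h1 h2
    simp only [det3, dot3, Pi.sub_apply]
    linear_combination z 0 * h0 + z 1 * h1 + z 2 * h2
  have h3 : m * dot3 a (v 3 - v 0) ≠ 0 := by
    rw [← hdet]; exact hv.1
  have hm0 : m ≠ 0 := left_ne_zero_of_mul h3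
  have ha1 : dot3 a (v 1 - v 0) = 0 := by
    apply (mul_eq_zero.1 ((hdet _).symm.trans _)).resolve_left hm0
    simp only [det3]; ring
  have ha2 : dot3 a (v 2 - v 0) = 0 := by
    apply (mul_eq_zero.1 ((hdet _).symm.trans _)).resolve_left hm0
    simp only [det3]; ring
  have hvol : vol ![v 0, v 1, v 2, v 0 + g] = m := by
    have h := hdet g
    rw [hag, mul_one] at h
    rw [← h]
    simp [vol]
  -- Its lattice points have `a`-level `0`, hence lie in the empty facet, or `1`, hence equal the
  -- new apex. The facet criterion then makes `m` a unit.
  have hE : IsEmptyTet ![v 0, v 1, v 2, v 0 + g] := by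
    refine ⟨by rwa [hvol], fun z hz => ?_⟩
    obtain ⟨l, hl, hs, hzl⟩ := mem_tet.1 hz
    simp only [Fin.sum_univ_four, latticePt, Matrix.cons_val_zero, Matrix.cons_val_one,
      Matrix.cons_val, Pi.add_apply, Int.cast_add] at hs hzl
    have hd : (dot3 a (z - v 0) : ℝ) = l 3 := by
      have h1' : (dot3 a (v 1 - v 0) : ℝ) = 0 := by exact_mod_cast ha1
      have h2' : (dot3 a (v 2 - v 0) : ℝ) = 0 := by exact_mod_cast ha2
      have h3' : (dot3 a g : ℝ) = 1 := by exact_mod_cast hag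
      simp only [dot3, Pi.sub_apply] at h1' h2' h3' ⊢
      push_cast at h1' h2' h3' ⊢
      rw [hzl, hzl, hzl]
      linear_combination l 1 * h1' + l 2 * h2' + l 3 * h3' +
        (a 0 * v 0 0 + a 1 * v 0 1 + a 2 * v 0 2) * hs
    have hle : (dot3 a (z - v 0) : ℝ) ≤ 1 := by linarith [hl 0, hl 1, hl 2]
    have hge : (0 : ℝ) ≤ dot3 a (z - v 0) := by linarith [hl 3]
    have hle' : dot3 a (z - v 0) ≤ 1 := by exact_mod_cast hle
    have hge' : 0 ≤ dot3 a (z - v 0) := by exact_mod_cast hge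
    rcases (by omega : dot3 a (z - v 0) = 0 ∨ dot3 a (z - v 0) = 1) with h | h
    · have e3 : l 3 = 0 := by rw [← hd, h]; simp
      have hzt : latticePt z ∈ tet v := by
        refine mem_tet.2 ⟨l, hl, by rw [Fin.sum_univ_four, hs], fun j => ?_⟩
        rw [Fin.sum_univ_four]
        have := hzl j
        rw [e3] at this ⊢
        simp only [latticePt]
        rw [this]; ring
      obtain ⟨i, rfl⟩ := hv.2 z hzt
      fin_cases i
      · exact ⟨0, rfl⟩
      · exact ⟨1, rfl⟩
      · exact ⟨2, rfl⟩
      · exact absurd (by simpa using Or.inr h) h3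
    · refine ⟨3, ?_⟩
      rw [h] at hd
      push_cast at hd
      have e0 : l 0 = 0 := by linarith [hl 0, hl 1, hl 2]
      have e1 : l 1 = 0 := by linarith [hl 0, hl 1, hl 2]
      have e2 : l 2 = 0 := by linarith [hl 0, hl 1, hl 2]
      ext j
      have := hzl j
      rw [e0, e1, e2, ← hd] at this
      simp only [one_mul, zero_mul, zero_add] at this
      simp only [Matrix.cons_val, Pi.add_apply]
      exact_mod_cast this.symm
  have hm1 := hE.natAbs_vol_eq_one_of_facet (a := a) (by simpa using ha1) (by simpa using ha2)
    (by simpa using hag)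
  rw [hvol] at hm1
  refine ⟨fun i => m * g i, ?_⟩
  have hmm : m * m = 1 := by
    rcases Int.natAbs_eq_iff.1 hm1 with h | h <;> rw [h] <;> rfl
  rw [hdet, ← hmm]
  simp only [dot3] at hag ⊢
  linear_combination m * m * hag

/-- Coordinates in which an empty tetrahedron is `0, (1,0,0), (0,1,0), (-A,-B,q)`. -/
theorem IsEmptyTet.exists_normal_form {v : Fin 4 → Fin 3 → ℤ} (hv : IsEmptyTet v) :
    ∃ (g : Fin 3 → ℤ) (ε q A B : ℤ), ε * ε = 1 ∧ 0 ≤ A ∧ A < q ∧ 0 ≤ B ∧ B < q ∧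
      det3 (v 1 - v 0) (v 2 - v 0) g = ε ∧
      ∀ j, v 3 j - v 0 j = q * g j - A * (v 1 j - v 0 j) - B * (v 2 j - v 0 j) := by
  obtain ⟨g, hg⟩ := hv.exists_completion
  have hv0 := hv.1
  obtain ⟨ε, q, hε, hq, hvq⟩ : ∃ ε q : ℤ, ε * ε = 1 ∧ 0 < q ∧ vol v = ε * q := by
    rcases lt_or_gt_of_ne hv0 with h | h
    · exact ⟨-1, -vol v, rfl, by omega, by ring⟩
    · exact ⟨1, vol v, rfl, by omega, by ring⟩
  obtain ⟨α, β, hαβ⟩ : ∃ α β : ℤ, ∀ j, v 3 j - v 0 j =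
      α * (v 1 j - v 0 j) + β * (v 2 j - v 0 j) + vol v * g j := by
    refine ⟨det3 (v 3 - v 0) (v 2 - v 0) g, det3 (v 1 - v 0) (v 3 - v 0) g, fun j => ?_⟩
    have : (v 3 j - v 0 j) * det3 (v 1 - v 0) (v 2 - v 0) g =
        det3 (v 3 - v 0) (v 2 - v 0) g * (v 1 j - v 0 j) +
        det3 (v 1 - v 0) (v 3 - v 0) g * (v 2 j - v 0 j) + vol v * g j := by
      fin_cases j <;> simp [det3, vol] <;> ring
    rwa [hg, mul_one] at this
  have hA := Int.mul_ediv_add_emod (-α) q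
  have hB := Int.mul_ediv_add_emod (-β) q
  refine ⟨fun j => ε * g j - (-α) / q * (v 1 j - v 0 j) - (-β) / q * (v 2 j - v 0 j), ε, q,
    (-α) % q, (-β) % q, hε, Int.emod_nonneg _ hq.ne', Int.emod_lt_of_pos _ hq,
    Int.emod_nonneg _ hq.ne', Int.emod_lt_of_pos _ hq, ?_, fun j => ?_⟩
  · simp only [det3, Pi.sub_apply] at hg ⊢
    linear_combination ε * hg
  · rw [hαβ, hvq]
    linear_combination (v 1 j - v 0 j) * hA + (v 2 j - v 0 j) * hB

/-- If the inequality failed, the lattice point with barycentric coordinates `(q-r-s-k)/q, r/q, s/q,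
k/q`, for `r, s` the two residues, would lie in the tetrahedron at height strictly between `0` and
`q`. -/
theorem IsEmptyTet.lt_residues {v : Fin 4 → Fin 3 → ℤ} (hv : IsEmptyTet v) {g : Fin 3 → ℤ}
    {ε q A B : ℤ} (hε : ε ≠ 0) (hdet : det3 (v 1 - v 0) (v 2 - v 0) g = ε)
    (h3 : ∀ j, v 3 j - v 0 j = q * g j - A * (v 1 j - v 0 j) - B * (v 2 j - v 0 j))
    {k : ℤ} (hk : 1 ≤ k) (hkq : k < q) : q < k * A % q + k * B % q + k := by
  by_contra! hle
  have hq : 0 < q := by omega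
  have hA := Int.mul_ediv_add_emod (k * A) q
  have hB := Int.mul_ediv_add_emod (k * B) q
  have hA0 := Int.emod_nonneg (k * A) hq.ne'
  have hB0 := Int.emod_nonneg (k * B) hq.ne'
  generalize k * A % q = r at hle hA hA0
  generalize k * B % q = s at hle hB hB0
  generalize k * A / q = α at hA
  generalize k * B / q = β at hB
  have hqR : (0 : ℝ) < q := by exact_mod_cast hq
  have hz : latticePt (fun j => v 0 j + k * g j - α * (v 1 j - v 0 j) - β * (v 2 j - v 0 j)) ∈
      tet v := by
    rw [tet_eq_dil_one]
    have c0 : (0 : ℝ) ≤ q - r - s - k := by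
      have : 0 ≤ q - r - s - k := by omega
      exact_mod_cast this
    have c1 : (0 : ℝ) ≤ r := by exact_mod_cast hA0
    have c2 : (0 : ℝ) ≤ s := by exact_mod_cast hB0
    have c3 : (0 : ℝ) ≤ k := by
      have : 0 ≤ k := by omega
      exact_mod_cast this
    refine mem_dil_of ((q - r - s - k) / q) (r / q) (s / q) (k / q) (div_nonneg c0 hqR.le)
      (div_nonneg c1 hqR.le) (div_nonneg c2 hqR.le) (div_nonneg c3 hqR.le) ?_ fun j => ?_
    · field_simp
      ring
    · have h3' : (v 3 j : ℝ) - v 0 j =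
          q * g j - A * (v 1 j - v 0 j) - B * (v 2 j - v 0 j) := by
        exact_mod_cast h3 j
      have hA' : (q : ℝ) * α + r = k * A := by exact_mod_cast hA
      have hB' : (q : ℝ) * β + s = k * B := by exact_mod_cast hB
      simp only [latticePt]
      push_cast
      field_simp
      linear_combination (-(k : ℝ)) * h3' - (v 1 j - v 0 j : ℝ) * hA' - (v 2 j - v 0 j : ℝ) * hB'
  obtain ⟨i, hi⟩ := hv.2 _ hz
  have hd : det3 (v 1 - v 0) (v 2 - v 0) (v i - v 0) = k * ε := by
    have hi' : ∀ j, v i j = v 0 j + k * g j - α * (v 1 j - v 0 j) - β * (v 2 j - v 0 j) :=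
      fun j => congrFun hi j
    simp only [det3, Pi.sub_apply, hi'] at hdet ⊢
    linear_combination k * hdet
  have hkε : k * ε ≠ 0 := mul_ne_zero (by omega) hε
  fin_cases i <;> simp only [Fin.zero_eta, Fin.mk_one, Fin.reduceFinMk, Fin.isValue] at hd
  · exact hkε (by rw [← hd]; simp [det3])
  · exact hkε (by rw [← hd]; simp only [det3]; ring)
  · exact hkε (by rw [← hd]; simp only [det3]; ring)
  · have : det3 (v 1 - v 0) (v 2 - v 0) (v 3 - v 0) = q * ε := by
      simp only [det3, Pi.sub_apply, h3] at hdet ⊢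
      linear_combination q * hdet
    rw [this] at hd
    have := mul_right_cancel₀ hε hd
    omega

theorem IsEmptyTet.covered_dil {v : Fin 4 → Fin 3 → ℤ} (hv : IsEmptyTet v) {k : ℕ}
    (hk : 2 ≤ k) : ∀ x ∈ dil v k, Covered (dil v k) x := by
  obtain ⟨g, ε, q, A, B, hε, hA0, hAq, hB0, hBq, hdet, h3⟩ := hv.exists_normal_form
  have hε0 : ε ≠ 0 := by rintro rfl; simp at hε
  have hwhite := residues_opposite hA0 hAq hB0 hBq
    fun k hk hkq => hv.lt_residues hε0 hdet h3 hk hkq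
  -- the linear form with values `i`, `j`, `1` on `v 1 - v 0`, `v 2 - v 0`, `g`
  have form : ∀ i j : ℤ, ∃ a : Fin 3 → ℤ, dot3 a (v 1 - v 0) = i ∧ dot3 a (v 2 - v 0) = j ∧
      dot3 a g = 1 := by
    intro i j
    refine ⟨fun c => ε * (i * cross3 (v 2 - v 0) g c + j * cross3 g (v 1 - v 0) c +
      cross3 (v 1 - v 0) (v 2 - v 0) c), ?_, ?_, ?_⟩ <;>
      simp only [dot3, cross3, det3, Matrix.cons_val_zero, Matrix.cons_val_one, Matrix.cons_val,
        Pi.sub_apply] at hdet ⊢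
    · linear_combination ε * i * hdet + i * hε
    · linear_combination ε * j * hdet + j * hε
    · linear_combination ε * hdet + hε
  have concl : ∀ i j : ℤ, (i = 0 ∨ i = 1) → (j = 0 ∨ j = 1) →
      (q - A * i - B * j = 0 ∨ q - A * i - B * j = 1) →
      ∀ x ∈ dil v k, Covered (dil v k) x := by
    -- The form takes the values `0, i, j, q - A i - B j` on the vertices relative to `v 0`; each
    -- alternative of White's theorem makes all four lie in `{0, 1}`.
    intro i j hi hj hij
    obtain ⟨a, a1, a2, ag⟩ := form i j
    have a3 : dot3 a (v 3 - v 0) = q - A * i - B * j := by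
      simp only [dot3, Pi.sub_apply, h3] at a1 a2 ag ⊢
      linear_combination q * ag - A * a1 - B * a2
    rw [dot3_sub] at a1 a2 a3
    generalize q - A * i - B * j = n at hij a3
    refine covered_dil_of_levels hv (a := a) (c := dot3 a (v 0)) ⟨g, ag⟩ (fun m => ?_) hk
    match m with
    | 0 => exact Or.inl rfl
    | 1 => omega
    | 2 => omega
    | 3 => omega
  rcases hwhite with h | h | h
  · exact concl 1 0 (by simp) (by simp) (by right; rw [h]; ring)
  · exact concl 0 1 (by simp) (by simp) (by right; rw [h]; ring)
  · exact concl 1 1 (by simp) (by simp) (by left; rw [← h]; ring)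

/-! ### Lattice polytopes -/

theorem vol_ne_zero_of_affineIndependent {v : Fin 4 → Fin 3 → ℤ}
    (h : AffineIndependent ℝ fun i => latticePt (v i)) : vol v ≠ 0 := by
  intro h0
  rw [← vol_eq_det_homogeneous] at h0
  obtain ⟨w, hw0, hw⟩ := Matrix.exists_vecMul_eq_zero_iff.2 h0
  apply hw0
  have hc : ∀ c, ∑ i, w i * ![1, v i 0, v i 1, v i 2] c = 0 := fun c => congrFun hw c
  have key := (affineIndependent_iff.1 h) Finset.univ (fun i => (w i : ℝ)) ?_ ?_
  · ext i
    have := key i (Finset.mem_univ i)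
    exact_mod_cast this
  · have := hc 0
    simp only [Matrix.cons_val_zero, mul_one] at this
    exact_mod_cast this
  · ext j
    simp only [Finset.sum_apply, Pi.smul_apply, smul_eq_mul, latticePt, Pi.zero_apply]
    have : ∑ i, w i * v i j = 0 := by
      fin_cases j
      · exact hc 1
      · exact hc 2
      · exact hc 3
    exact_mod_cast this

/-- An affinely independent subset of a set spanning the whole space extends, inside the set, to
an affinely independent set spanning the whole space. -/
theorem exists_affineIndependent_extension {V : Type*} [AddCommGroup V] [Module ℝ V]
    {s t : Set V} (hts : t ⊆ s) (hne : t.Nonempty)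
    (ht : AffineIndependent ℝ ((↑) : t → V)) (hs : affineSpan ℝ s = ⊤) :
    ∃ u, t ⊆ u ∧ u ⊆ s ∧ AffineIndependent ℝ ((↑) : u → V) ∧ affineSpan ℝ u = ⊤ := by
  obtain ⟨p, hp⟩ := hne
  rw [affineIndependent_set_iff_linearIndependent_vsub ℝ hp, linearIndependent_subtype_iff] at ht
  have hsub : (fun x => x -ᵥ p) '' (t \ {p}) ⊆ (fun x => x -ᵥ p) '' s :=
    Set.image_mono (Set.sdiff_subset.trans hts)
  have hb := ht.subset_extend hsub
  have hbs := ht.extend_subset hsub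
  have hspan := ht.subset_span_extend hsub
  have hli := ht.linearIndepOn_extend hsub
  generalize ht.extend hsub = b at hb hbs hspan hli
  have h0 : ∀ v ∈ b, v ≠ 0 := fun v hv => hli.ne_zero hv
  have htop : Submodule.span ℝ b = ⊤ := by
    rw [eq_top_iff, ← AffineSubspace.direction_top ℝ V V, ← hs, direction_affineSpan,
      vectorSpan_eq_span_vsub_set_right ℝ (hts hp)]
    exact Submodule.span_le.2 hspan
  rw [← linearIndependent_subtype_iff,
    linearIndependent_set_iff_affineIndependent_vadd_union_singleton ℝ h0 p] at hli
  refine ⟨{p} ∪ (fun v => v +ᵥ p) '' b, ?_, ?_, hli,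
    affineSpan_singleton_union_vadd_eq_top_of_span_eq_top p ?_⟩
  · intro x hx
    by_cases hxp : x = p
    · exact Or.inl hxp
    · exact Or.inr ⟨x -ᵥ p, hb ⟨x, ⟨hx, hxp⟩, rfl⟩, by simp⟩
  · rintro x (rfl | ⟨y, hy, rfl⟩)
    · exact hts hp
    · obtain ⟨z, hz, rfl⟩ := hbs hy
      simpa using hz
  · simpa using htop

theorem exists_tet_of_mem_convexHull {S : Set (Fin 3 → ℤ)}
    (hS : affineSpan ℝ (latticePt '' S) = ⊤) {x : Fin 3 → ℝ}
    (hx : x ∈ convexHull ℝ (latticePt '' S)) :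
    ∃ v : Fin 4 → Fin 3 → ℤ, (∀ i, v i ∈ S) ∧ vol v ≠ 0 ∧ x ∈ tet v := by
  rw [convexHull_eq_union] at hx
  simp only [Set.mem_iUnion, exists_prop] at hx
  obtain ⟨t, hts, hti, hxt⟩ := hx
  have hne : (t : Set (Fin 3 → ℝ)).Nonempty := convexHull_nonempty_iff.1 ⟨x, hxt⟩
  obtain ⟨u, htu, hus, hui, htop⟩ := exists_affineIndependent_extension hts hne hti hS
  have hfin : u.Finite := finite_set_of_fin_dim_affineIndependent ℝ hui
  have := hfin.fintype
  have hcard : Fintype.card u = 4 := by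
    have h := (hui.affineSpan_eq_top_iff_card_eq_finrank_add_one).1 (by simpa using htop)
    simpa using h
  have e : Fin 4 ≃ u := (Fintype.equivFinOfCardEq hcard).symm
  choose z hzS hz using fun i => hus (e i).2
  have hze : (fun i => latticePt (z i)) = (fun y : u => (y : Fin 3 → ℝ)) ∘ e := funext hz
  refine ⟨z, hzS, vol_ne_zero_of_affineIndependent ?_, ?_⟩
  · rw [hze]
    exact hui.comp_embedding e.toEmbedding
  · rw [tet, hze, e.surjective.range_comp, Subtype.range_coe]
    exact convexHull_mono htu hxt

/-- Krein–Milman: the slab is closed and convex and contains the extreme points. -/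
theorem dot_bounds_of_extremePoints {P : Set (Fin 3 → ℝ)} (hc : IsCompact P) (hP : Convex ℝ P)
    {a : Fin 3 → ℤ} {c : ℤ}
    (h : P.extremePoints ℝ ⊆ latticeHyperplane a c ∪ latticeHyperplane a (c + 1)) :
    ∀ x ∈ P, (c : ℝ) ≤ ∑ i, (a i : ℝ) * x i ∧ ∑ i, (a i : ℝ) * x i ≤ c + 1 := by
  have hcont : Continuous fun x : Fin 3 → ℝ => ∑ i, (a i : ℝ) * x i := by fun_prop
  have hlin : IsLinearMap ℝ fun x : Fin 3 → ℝ => ∑ i, (a i : ℝ) * x i := by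
    constructor
    · intro x y; simp [mul_add, Finset.sum_add_distrib]
    · intro r x
      simp only [Pi.smul_apply, smul_eq_mul, Finset.mul_sum]
      exact Finset.sum_congr rfl fun i _ => by ring
  have hsub : closure (convexHull ℝ (P.extremePoints ℝ)) ⊆
      {x | (c : ℝ) ≤ ∑ i, (a i : ℝ) * x i} ∩ {x | ∑ i, (a i : ℝ) * x i ≤ c + 1} := by
    refine closure_minimal (convexHull_min (fun x hx => ?_) ?_) ?_
    · rcases h hx with h | h
      · have h' : ∑ i, (a i : ℝ) * x i = c := h
        exact ⟨h'.ge, by simp only [Set.mem_ofPred_eq]; linarith⟩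
      · have h' : ∑ i, (a i : ℝ) * x i = ((c + 1 : ℤ) : ℝ) := h
        push_cast at h'
        exact ⟨by simp only [Set.mem_ofPred_eq]; linarith, h'.le⟩
    · exact (convex_halfSpace_ge hlin _).inter (convex_halfSpace_le hlin _)
    · exact (isClosed_le continuous_const hcont).inter (isClosed_le hcont continuous_const)
  rw [closure_convexHull_extremePoints hc hP] at hsub
  exact fun x hx => hsub hx

theorem hasUnimodularCover_of_hasWidthOne {P : Set (Fin 3 → ℝ)} (hP : IsLatticeFullPolytope P)
    (hw : HasWidthOne P) {k : ℕ} (hk : 2 ≤ k) : HasUnimodularCover ((k : ℝ) • P) := by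
  obtain ⟨⟨S, -, rfl⟩, htop⟩ := hP
  obtain ⟨a, c, ha, hext⟩ := hw
  have hkR : (0 : ℝ) < k := by
    have : 0 < k := by omega
    exact_mod_cast this
  have hcpt : IsCompact (convexHull ℝ (latticePt '' (S : Set (Fin 3 → ℤ)))) :=
    (S.finite_toSet.image _).isCompact_convexHull ℝ
  have hbd := dot_bounds_of_extremePoints hcpt (convex_convexHull ℝ _) hext
  rw [affineSpan_convexHull] at htop
  apply hasUnimodularCover_of_covered
  rintro _ ⟨y, hy, rfl⟩
  obtain ⟨v, hvS, hv, hyv⟩ := exists_tet_of_mem_convexHull htop hy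
  obtain ⟨w, hwe, hyw, hwv⟩ := exists_isEmptyTet hv hyv
  have hwP : tet w ⊆ convexHull ℝ (latticePt '' (S : Set (Fin 3 → ℤ))) :=
    hwv.trans (tet_subset (convex_convexHull ℝ _) fun i =>
      subset_convexHull ℝ _ ⟨v i, hvS i, rfl⟩)
  have hlev : ∀ i, dot3 a (w i) = c ∨ dot3 a (w i) = c + 1 := by
    intro i
    obtain ⟨b1, b2⟩ := hbd _ (hwP (latticePt_mem_tet w i))
    have e : ∑ j, (a j : ℝ) * latticePt (w i) j = (dot3 a (w i) : ℝ) := by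
      simp [Fin.sum_univ_three, latticePt, dot3]
    rw [e] at b1 b2
    have b1' : c ≤ dot3 a (w i) := by exact_mod_cast b1
    have b2' : dot3 a (w i) ≤ c + 1 := by exact_mod_cast b2
    omega
  have hcov := covered_dil_of_levels hwe (exists_dot3_eq_one ha) hlev hk
  rw [← smul_tet w hkR] at hcov
  exact (hcov _ ⟨y, hyw, rfl⟩).mono (Set.smul_set_mono hwP)

theorem mainTheorem6 :
    (∀ P : Set (Fin 3 → ℝ), IsLatticeFullPolytope P → HasWidthOne P →
      ∀ k : ℕ, 2 ≤ k → HasUnimodularCover ((k : ℝ) • P)) ∧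
    (∀ T : Set (Fin 3 → ℝ), IsEmptyTetrahedron T →
      ∀ k : ℕ, 2 ≤ k → HasUnimodularCover ((k : ℝ) • T)) := by
  refine ⟨fun P hP hw k hk => hasUnimodularCover_of_hasWidthOne hP hw hk, ?_⟩
  rintro _ ⟨v, hv, rfl, hempty⟩ k hk
  have hkR : (0 : ℝ) < k := by
    have : 0 < k := by omega
    exact_mod_cast this
  have hE : IsEmptyTet v := ⟨vol_ne_zero_of_affineIndependent hv, hempty⟩
  change HasUnimodularCover ((k : ℝ) • tet v)
  rw [smul_tet v hkR]
  exact hasUnimodularCover_of_covered (hE.covered_dil hk)
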